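/- Let $1<\alpha\le 1+\frac1{1000}$ and $0<\theta<\alpha-1$. A sequence $(\varphi_s)$ of complex-valued functions on $\mathbb R$, indexed by the dyadic numbers $s=2^k$, $k=0,1,2,\dots$, is called uniformly in $C_c^\infty(\frac12,2)$ if every $\varphi_s$ is smooth, all $\varphi_s$ are supported in one compact subinterval of $(\frac12,2)$, and $\sup_{s}\|\varphi_s^{(j)}\|_\infty<\infty$ for every $j\ge 0$. For such a sequence and a real number $M\ge 0$ let $\mathbb H_M$ be the operator on $\ell^2(\mathbb Z)$ $$\mathbb H_M f(x)=\sum_{\substack{M^\theta\le s\le M\\ s\ \text{dyadic}}}\ \sum_{m>0}\varphi_s\Big(\frac{m^\alpha}{s}\Big)\frac{f(x-[m^\alpha])-f(x+[m^\alpha])}{m},\qquad x\in\mathbb Z,$$ where $[\cdot]$ denotes the integer part. Then there exist a sequence $(\varphi_s)$ uniformly in $C_c^\infty(\frac12,2)$ and a compact set $\Gamma\subset\mathbb C$ such that: (a) there is a constant $C_I$ such that for all $M\ge 0$ and all $\lambda\in\Gamma$ the operator $\lambda\,\mathrm{Id}+\mathbb H_M$ is invertible on $\ell^2(\mathbb Z)$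 and $\|(\lambda\,\mathrm{Id}+\mathbb H_M)^{-1}\|_{\ell^2\to\ell^2}\le C_I$; (b) there is no constant $C$ such that for all $M\ge 0$, all $\lambda\in\Gamma$ and all $f\in\ell^1(\mathbb Z)$ $$\sup_{t>0}\, t\,\#\{x\in\mathbb Z: |(\lambda\,\mathrm{Id}+\mathbb H_M)^{-1}f(x)|>t\}\le C\,\|f\|_{\ell^1},$$ that is, the estimate $\|(\lambda\,\mathrm{Id}+\mathbb H_M)^{-1}\|_{\ell^1\to\ell^{1,\infty}}\le C$ does not, for any $C$, hold uniformly in $\lambda\in\Gamma$ and $M$. -/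

import Mathlib

open scoped ENNReal NNReal ContDiff

namespace RoughHilbert

/-- The Hilbert space of square summable functions on the integers. -/
abbrev EllTwo : Type := lp (fun _ : ℤ => ℂ) 2

theorem two_toReal_pos : 0 < (2 : ℝ≥0∞).toReal := by norm_num

theorem memℓp_shift (n : ℤ) (f : EllTwo) :
    Memℓp (fun x : ℤ => f (x - n)) 2 := by
  rw [memℓp_gen_iff two_toReal_pos]
  exact (Equiv.subRight n).summable_iff.mpr ((memℓp_gen_iff two_toReal_pos).mp (lp.memℓp f))

/-- Translation by `n` on square summable functions, `f ↦ (x ↦ f (x - n))`. -/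
noncomputable def shift (n : ℤ) : EllTwo →L[ℂ] EllTwo :=
  LinearMap.mkContinuous
    { toFun := fun f => ⟨fun x : ℤ => f (x - n), memℓp_shift n f⟩
      map_add' := fun _ _ => rfl
      map_smul' := fun _ _ => rfl } 1 (by
    intro f
    rw [one_mul, lp.norm_eq_tsum_rpow two_toReal_pos, lp.norm_eq_tsum_rpow two_toReal_pos]
    exact le_of_eq (congrArg (fun r : ℝ => r ^ (1 / (2 : ℝ≥0∞).toReal))
      ((Equiv.subRight n).tsum_eq (fun x : ℤ => ‖f x‖ ^ (2 : ℝ≥0∞).toReal))))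

theorem shift_apply (n : ℤ) (f : EllTwo) (x : ℤ) : shift n f x = f (x - n) := rfl

/-- The sequence `φ` is uniformly in `C_c^∞(1/2, 2)`: every member is smooth, all of them are
supported in one compact subinterval of `(1/2, 2)`, and the derivatives of each order are bounded
uniformly along the sequence. The member `φ k` is the cutoff at the dyadic scale `2 ^ k`. -/
structure IsUniformCutoff (φ : ℕ → ℝ → ℂ) : Prop where
  smooth : ∀ k, ContDiff ℝ ∞ (φ k)
  support : ∃ a b : ℝ, 1 / 2 < a ∧ b < 2 ∧ ∀ k, tsupport (φ k) ⊆ Set.Icc a b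
  bound : ∀ j : ℕ, ∃ B : ℝ, ∀ k t, ‖iteratedDeriv j (φ k) t‖ ≤ B

/-- The single scale operator
`f ↦ ∑_{m > 0} ψ (m ^ α / s) (f (x - [m ^ α]) - f (x + [m ^ α])) / m`.
Only finitely many terms are non-zero when `ψ` has compact support and `α, s > 0`. -/
noncomputable def hilbertPiece (α s : ℝ) (ψ : ℝ → ℂ) : EllTwo →L[ℂ] EllTwo :=
  ∑ᶠ (m : ℕ) (_ : 0 < m),
    (ψ ((m : ℝ) ^ α / s) / (m : ℂ)) • (shift ⌊(m : ℝ) ^ α⌋ - shift (-⌊(m : ℝ) ^ α⌋))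

/-- The truncated rough Hilbert transform: the sum of the single scale operators over the dyadic
`s = 2 ^ k` with `M ^ θ ≤ s ≤ M`. For `M ≥ 0` and `0 < θ < 1` such `s` are at least `1`, so that
`k` may be taken in `ℕ`, and they are finite in number. -/
noncomputable def truncatedHilbert (α θ : ℝ) (φ : ℕ → ℝ → ℂ) (M : ℝ) : EllTwo →L[ℂ] EllTwo :=
  ∑ᶠ (k : ℕ) (_ : M ^ θ ≤ (2 : ℝ) ^ k ∧ (2 : ℝ) ^ k ≤ M), hilbertPiece α ((2 : ℝ) ^ k) (φ k)

/-- The weak `ℓ¹` quasinorm `sup_{t > 0} t * #{x : |g x| > t}`. -/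
noncomputable def weakNorm (g : ℤ → ℂ) : ℝ≥0∞ :=
  ⨆ t : ℝ≥0, (t : ℝ≥0∞) * ({x : ℤ | (t : ℝ) < ‖g x‖}.encard : ℝ≥0∞)

/-- The `ℓ¹ → ℓ^{1,∞}` norm of `T` is at most `C`. Every function in `ℓ¹` is in `ℓ²`. -/
def WeakTypeBound (T : EllTwo →L[ℂ] EllTwo) (C : ℝ≥0) : Prop :=
  ∀ f : EllTwo, Memℓp (fun x : ℤ => f x) 1 →
    weakNorm (fun x : ℤ => T f x) ≤ (C : ℝ≥0∞) * ∑' x : ℤ, ‖f x‖ₑ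

end RoughHilbert

/-!
All cutoffs are real, so that every truncation `H_M` is skew-adjoint and `‖(1 + H_M)⁻¹‖ ≤ 1` on
`ℓ²`; the single value `λ = 1` is enough, and only the failure of the weak type bound has to be
proved.

The cutoffs are one fixed bump function at a sparse set of scales and `0` elsewhere. The active
scales come in pairs of blocks, the `N`-th pair consisting of `N` consecutive scales from `2 ^ k`
on and `N` consecutive scales from `2 ^ l` on. The pairs are so far apart that the truncation at
the top of the lower block is the sum `a` of the operators of that block, and the truncation at the
top of the upper block is `a + b`. Let `X` and `Y` denote the orders of the `m` with `m ^ α ∼ 2 ^ k`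
and `m ^ α ∼ 2 ^ l`. As `θ < α - 1`, it is possible to have `X` much smaller than `Y ^ (α - 1)` and
nevertheless all scales above the lower cut-off `M ^ θ` (`exists_block_positions`).

With `u = (1 + a)⁻¹` and `T = (1 + a + b)⁻¹` there is the identity
`2 a b = T - u + b + (3 + 2 a) u² a² b - u² T b²` (`two_mul_mul_eq_of_commute`), which is applied to
the unit mass at `0`.

* The kernel of `a b` has size about `1 / (X Y)` on about `N X Y` points: the scales `2 ^ (k + i)`
  and `2 ^ (l + N - 1 - i)` have the same product for all `i < N`, and since `X Y` is much smaller
  than `Y ^ α`, hardly any of the sums `± ⌊m ^ α⌋ ± ⌊n ^ α⌋` coincide (`exists_pairs`,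
  `exists_unique_sums`). Thus its weak `ℓ¹` norm is at least a multiple of `N`.
* The kernels of `T` and `u` have weak norm at most `C` if there is a uniform weak type bound `C`,
  and `b` has only `O(Y)` points in its support.
* The kernels of `a² b` and `b²` are small in `ℓ²`, the norm in which the resolvents are bounded
  (`exists_norm_conv_conv_conv_delta_sq_le`, `exists_norm_conv_sq_delta_sq_le`). This rests on the
  count of the solutions of `⌊n' ^ α⌋ - ⌊n ^ α⌋ = x` for `0 < |x| ≤ Y` in
  `exists_card_pairs_le`, which is as good as equidistribution would give.

So `N ≤ 100 (24 C + 3)` for every `N` (`exists_natCast_le_of_weakTypeBound`), which is absurd.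
-/

namespace RoughHilbert

/-! ### Translations and finite convolution operators -/

theorem shift_mul_shift (m n : ℤ) : shift m * shift n = shift (m + n) := by
  ext f x
  rw [mul_apply_eq_comp, shift_apply, shift_apply, shift_apply, sub_sub]

theorem shift_zero : shift 0 = 1 := by
  ext f x
  simp [shift_apply]

theorem inner_shift_shift (n : ℤ) (f g : EllTwo) :
    inner ℂ (shift n f) (shift n g) = inner ℂ f g := by
  rw [lp.inner_eq_tsum, lp.inner_eq_tsum]
  exact (Equiv.subRight n).tsum_eq (fun x : ℤ => inner ℂ (f x) (g x))

theorem norm_shift_apply (n : ℤ) (f : EllTwo) : ‖shift n f‖ = ‖f‖ := by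
  have h := inner_shift_shift n f f
  rw [inner_self_eq_norm_sq_to_K, inner_self_eq_norm_sq_to_K] at h
  have h' : ‖shift n f‖ ^ 2 = ‖f‖ ^ 2 := by exact_mod_cast h
  exact (pow_left_inj₀ (norm_nonneg _) (norm_nonneg _) two_ne_zero).mp h'

theorem inner_shift_left (m n : ℤ) (f g : EllTwo) :
    inner ℂ (shift m f) (shift n g) = inner ℂ (shift (m - n) f) g := by
  rw [← inner_shift_shift n (shift (m - n) f) g, ← mul_apply_eq_comp,
    shift_mul_shift, add_sub_cancel]

theorem norm_shift_le (n : ℤ) : ‖shift n‖ ≤ 1 :=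
  ContinuousLinearMap.opNorm_le_bound _ zero_le_one fun f => by
    rw [norm_shift_apply, one_mul]

theorem adjoint_shift (n : ℤ) : ContinuousLinearMap.adjoint (shift n) = shift (-n) := by
  symm
  rw [ContinuousLinearMap.eq_adjoint_iff]
  intro f g
  rw [← inner_shift_shift n (shift (-n) f) g, ← mul_apply_eq_comp,
    shift_mul_shift, add_neg_cancel, shift_zero, one_apply_eq_self]

/-- The unit mass at `0`. -/
noncomputable def delta : EllTwo := lp.single 2 (0 : ℤ) (1 : ℂ)

theorem delta_apply (x : ℤ) : delta x = if x = 0 then 1 else 0 := by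
  simp [delta, Pi.single_apply]

theorem inner_shift_delta_left (x : ℤ) (f : EllTwo) : inner ℂ (shift x delta) f = f x := by
  rw [← inner_shift_shift (-x) (shift x delta) f, ← mul_apply_eq_comp,
    shift_mul_shift, neg_add_cancel, shift_zero, one_apply_eq_self, delta,
    lp.inner_single_left, shift_apply]
  simp

/-- Convolution with the finitely supported kernel equal to `κ` on `s` and to `0` elsewhere. -/
noncomputable def conv (s : Finset ℤ) (κ : ℤ → ℂ) : EllTwo →L[ℂ] EllTwo :=
  ∑ y ∈ s, κ y • shift y

theorem conv_apply (s : Finset ℤ) (κ : ℤ → ℂ) (f : EllTwo) (x : ℤ) :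
    conv s κ f x = ∑ y ∈ s, κ y * f (x - y) := by
  rw [conv, sum_apply, lp.coeFn_sum, Finset.sum_apply]
  rfl

theorem conv_delta_apply (s : Finset ℤ) (κ : ℤ → ℂ) (x : ℤ) :
    conv s κ delta x = if x ∈ s then κ x else 0 := by
  rw [conv_apply]
  simp [delta_apply, sub_eq_zero]

theorem norm_conv_le (s : Finset ℤ) (κ : ℤ → ℂ) : ‖conv s κ‖ ≤ ∑ y ∈ s, ‖κ y‖ := by
  refine (norm_sum_le _ _).trans (Finset.sum_le_sum fun y _ => ?_)
  rw [norm_smul]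
  exact mul_le_of_le_one_right (norm_nonneg _) (norm_shift_le y)

theorem norm_conv_delta_sq (s : Finset ℤ) (κ : ℤ → ℂ) :
    ‖conv s κ delta‖ ^ 2 = ∑ y ∈ s, ‖κ y‖ ^ 2 := by
  have h := lp.norm_rpow_eq_tsum two_toReal_pos (conv s κ delta)
  simp only [ENNReal.toReal_ofNat, Real.rpow_ofNat] at h
  rw [h, tsum_eq_sum (s := s)]
  · exact Finset.sum_congr rfl fun y hy => by rw [conv_delta_apply, if_pos hy]
  · intro y hy
    rw [conv_delta_apply, if_neg hy]
    simp

theorem conv_mul_conv (s t : Finset ℤ) (κ η : ℤ → ℂ) :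
    conv s κ * conv t η = ∑ y ∈ s, ∑ z ∈ t, (κ y * η z) • shift (y + z) := by
  rw [conv, conv, Finset.sum_mul_sum]
  refine Finset.sum_congr rfl fun y _ => Finset.sum_congr rfl fun z _ => ?_
  rw [smul_mul_smul_comm, shift_mul_shift]

theorem commute_conv (s t : Finset ℤ) (κ η : ℤ → ℂ) : Commute (conv s κ) (conv t η) := by
  rw [Commute, SemiconjBy, conv_mul_conv, conv_mul_conv, Finset.sum_comm]
  refine Finset.sum_congr rfl fun y _ => Finset.sum_congr rfl fun z _ => ?_
  rw [mul_comm, add_comm]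

/-- A product of finite convolutions is a finite convolution, supported in the sumset. -/
theorem exists_conv_eq_mul (s t : Finset ℤ) (κ η : ℤ → ℂ) :
    ∃ (r : Finset ℤ) (ν : ℤ → ℂ), conv s κ * conv t η = conv r ν ∧
      (∀ x ∈ r, ∃ y ∈ s, ∃ z ∈ t, x = y + z) ∧
      ∑ x ∈ r, ‖ν x‖ ≤ (∑ y ∈ s, ‖κ y‖) * ∑ z ∈ t, ‖η z‖ := by
  classical
  set r : Finset ℤ := (s ×ˢ t).image fun p => p.1 + p.2 with hr
  have hmaps : ∀ p ∈ s ×ˢ t, p.1 + p.2 ∈ r := fun p hp => Finset.mem_image_of_mem _ hp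
  refine ⟨r, fun x => ∑ p ∈ s ×ˢ t with p.1 + p.2 = x, κ p.1 * η p.2, ?_, ?_, ?_⟩
  · rw [conv_mul_conv, ← Finset.sum_product', conv, ← Finset.sum_fiberwise_of_maps_to hmaps]
    refine Finset.sum_congr rfl fun x _ => ?_
    rw [Finset.sum_smul]
    refine Finset.sum_congr rfl fun p hp => ?_
    rw [(Finset.mem_filter.mp hp).2]
  · intro x hx
    obtain ⟨p, hp, rfl⟩ := Finset.mem_image.mp hx
    exact ⟨p.1, (Finset.mem_product.mp hp).1, p.2, (Finset.mem_product.mp hp).2, rfl⟩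
  · rw [Finset.sum_mul_sum, ← Finset.sum_product', ← Finset.sum_fiberwise_of_maps_to hmaps]
    refine Finset.sum_le_sum fun x _ => (norm_sum_le _ _).trans (le_of_eq ?_)
    exact Finset.sum_congr rfl fun p _ => norm_mul _ _

/-- The diagonal terms of `‖conv s κ v‖ ^ 2` add up to `‖v‖ ^ 2 * ∑ ‖κ‖ ^ 2`, and the others see
only the correlations of `v` with its translates by the nonzero differences of `s`. -/
theorem norm_conv_apply_sq_le (s : Finset ℤ) (κ : ℤ → ℂ) (v : EllTwo) {σ : ℝ} (hσ₀ : 0 ≤ σ)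
    (hσ : ∀ y ∈ s, ∀ z ∈ s, y ≠ z → ‖inner ℂ (shift (y - z) v) v‖ ≤ σ) :
    ‖conv s κ v‖ ^ 2 ≤ ‖v‖ ^ 2 * ∑ y ∈ s, ‖κ y‖ ^ 2 + σ * (∑ y ∈ s, ‖κ y‖) ^ 2 := by
  classical
  have h1 : ‖conv s κ v‖ ^ 2 = ‖inner ℂ (conv s κ v) (conv s κ v)‖ := by
    rw [inner_self_eq_norm_sq_to_K]
    simp
  have h2 : inner ℂ (conv s κ v) (conv s κ v) =
      ∑ y ∈ s, ∑ z ∈ s, (starRingEnd ℂ (κ y) * κ z) * inner ℂ (shift (y - z) v) v := by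
    rw [conv, sum_apply, sum_inner]
    refine Finset.sum_congr rfl fun y _ => ?_
    rw [inner_sum]
    refine Finset.sum_congr rfl fun z _ => ?_
    rw [smul_apply, smul_apply, inner_smul_left,
      inner_smul_right, inner_shift_left, mul_assoc]
  rw [h1, h2]
  have h3 : ∀ y ∈ s, ∀ z ∈ s,
      ‖(starRingEnd ℂ (κ y) * κ z) * inner ℂ (shift (y - z) v) v‖ ≤
        (if y = z then ‖v‖ ^ 2 * ‖κ y‖ ^ 2 else 0) + σ * (‖κ y‖ * ‖κ z‖) := by
    intro y hy z hz
    rw [norm_mul, norm_mul, RCLike.norm_conj]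
    split_ifs with h
    · subst h
      rw [sub_self, shift_zero, one_apply_eq_self, inner_self_eq_norm_sq_to_K]
      have : 0 ≤ σ * (‖κ y‖ * ‖κ y‖) := by positivity
      simp only [norm_pow, Complex.coe_algebraMap, Complex.norm_real, norm_norm]
      nlinarith
    · rw [zero_add, mul_comm]
      exact mul_le_mul_of_nonneg_right (hσ y hy z hz h) (by positivity)
  calc _ ≤ ∑ y ∈ s, ∑ z ∈ s,
        ((if y = z then ‖v‖ ^ 2 * ‖κ y‖ ^ 2 else 0) + σ * (‖κ y‖ * ‖κ z‖)) :=
        (norm_sum_le _ _).trans (Finset.sum_le_sum fun y hy =>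
          (norm_sum_le _ _).trans (Finset.sum_le_sum fun z hz => h3 y hy z hz))
    _ = _ := by
      simp only [Finset.sum_add_distrib, Finset.sum_ite_eq]
      congr 1
      · rw [Finset.mul_sum]
        exact Finset.sum_congr rfl fun y hy => if_pos hy
      · rw [sq, Finset.sum_mul_sum, Finset.mul_sum]
        exact Finset.sum_congr rfl fun y _ => (Finset.mul_sum _ _ _).symm

theorem norm_inner_shift_conv_delta_le (s : Finset ℤ) (κ : ℤ → ℂ) {D : ℝ}
    (hD : ∀ y ∈ s, ‖κ y‖ ≤ D) (x : ℤ) :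
    ‖inner ℂ (shift x (conv s κ delta)) (conv s κ delta)‖ ≤
      D ^ 2 * ((s.filter fun y => y + x ∈ s).card : ℝ) := by
  have h : inner ℂ (shift x (conv s κ delta)) (conv s κ delta) =
      ∑ y ∈ s, starRingEnd ℂ (κ y) * (if y + x ∈ s then κ (y + x) else 0) := by
    conv_lhs => enter [2]; rw [conv, sum_apply, map_sum]
    rw [sum_inner]
    refine Finset.sum_congr rfl fun y _ => ?_
    rw [smul_apply, map_smul, inner_smul_left, ← mul_apply_eq_comp,
      shift_mul_shift, inner_shift_delta_left, conv_delta_apply, add_comm x y]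
  rw [h, mul_comm, ← nsmul_eq_mul, ← Finset.sum_const, Finset.sum_filter]
  refine (norm_sum_le _ _).trans (Finset.sum_le_sum fun y hy => ?_)
  split_ifs with hx
  · rw [norm_mul, RCLike.norm_conj, sq]
    exact mul_le_mul (hD y hy) (hD _ hx) (norm_nonneg _) ((norm_nonneg _).trans (hD y hy))
  · simp

/-- Chebyshev's inequality in `ℓ²`. -/
theorem card_mul_sq_le_norm_sq (v : EllTwo) (G : Finset ℤ) {t : ℝ} (ht : 0 ≤ t)
    (hG : ∀ x ∈ G, t < ‖v x‖) : (G.card : ℝ) * t ^ 2 ≤ ‖v‖ ^ 2 := by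
  have h := lp.sum_rpow_le_norm_rpow two_toReal_pos v G
  simp only [ENNReal.toReal_ofNat, Real.rpow_ofNat] at h
  refine le_trans ?_ h
  rw [← nsmul_eq_mul, ← Finset.sum_const]
  exact Finset.sum_le_sum fun x hx => pow_le_pow_left₀ ht (hG x hx).le 2

theorem WeakTypeBound.card_mul_le {T : EllTwo →L[ℂ] EllTwo} {C : ℝ≥0} (hT : WeakTypeBound T C)
    (G : Finset ℤ) {t : ℝ} (ht : 0 ≤ t) (hG : ∀ x ∈ G, t < ‖T delta x‖) :
    (G.card : ℝ) * t ≤ C := by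
  have hmem : Memℓp (fun x : ℤ => delta x) 1 := by
    have : (fun x : ℤ => delta x) = (lp.single 1 (0 : ℤ) (1 : ℂ) : lp (fun _ : ℤ => ℂ) 1) := by
      ext x
      simp [delta]
    rw [this]
    exact lp.memℓp _
  have h := hT delta hmem
  have hsum : ∑' x : ℤ, ‖delta x‖ₑ = 1 := by
    rw [tsum_eq_single 0]
    · simp [delta_apply]
    · intro x hx
      simp [delta_apply, hx]
  rw [hsum, mul_one] at h
  have h1 : ((t.toNNReal : ℝ≥0) : ℝ≥0∞) * ((G.card : ℕ∞) : ℝ≥0∞) ≤ C := by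
    refine le_trans ?_ (le_trans (le_iSup _ t.toNNReal) h)
    gcongr
    rw [← Set.encard_coe_eq_coe_finsetCard]
    refine Set.encard_le_encard fun x hx => ?_
    simpa [Real.coe_toNNReal t ht] using hG x hx
  have h2 : ((t.toNNReal * (G.card : ℝ≥0) : ℝ≥0) : ℝ≥0∞) ≤ C := by
    simpa using h1
  have h3 : t.toNNReal * (G.card : ℝ≥0) ≤ C := ENNReal.coe_le_coe.mp h2
  have h4 : ((t.toNNReal * (G.card : ℝ≥0) : ℝ≥0) : ℝ) ≤ C := NNReal.coe_le_coe.mpr h3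
  simpa [Real.coe_toNNReal t ht, mul_comm] using h4

/-! ### Resolvents of skew-adjoint operators -/

theorem norm_le_norm_one_add_apply {H : EllTwo →L[ℂ] EllTwo} (hH : H ∈ skewAdjoint _)
    (v : EllTwo) : ‖v‖ ≤ ‖(1 + H) v‖ := by
  have hre : RCLike.re (inner ℂ v (H v)) = 0 := by
    have h1 : inner ℂ (H v) v = -inner ℂ v (H v) := by
      rw [← ContinuousLinearMap.adjoint_inner_right, ← ContinuousLinearMap.star_eq_adjoint,
        skewAdjoint.mem_iff.mp hH]
      simp
    have h2 := inner_re_symm (𝕜 := ℂ) v (H v)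
    rw [h1] at h2
    simp only [map_neg] at h2
    linarith
  have h : ‖(1 + H) v‖ ^ 2 = ‖v‖ ^ 2 + ‖H v‖ ^ 2 := by
    rw [add_apply, one_apply_eq_self,
      norm_add_sq (𝕜 := ℂ), hre]
    ring
  exact (sq_le_sq₀ (norm_nonneg _) (norm_nonneg _)).mp (by nlinarith [sq_nonneg ‖H v‖])

theorem isUnit_one_add {H : EllTwo →L[ℂ] EllTwo} (hH : H ∈ skewAdjoint _) : IsUnit (1 + H) := by
  have hsa : IsSelfAdjoint (Complex.I • H) := by
    rw [isSelfAdjoint_iff, star_smul, skewAdjoint.mem_iff.mp hH]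
    simp
  by_contra hu
  have hmem : (-Complex.I) ∈ spectrum ℂ (Complex.I • H) := by
    rw [spectrum.mem_iff]
    intro h
    apply hu
    have h' : algebraMap ℂ (EllTwo →L[ℂ] EllTwo) (-Complex.I) - Complex.I • H =
        (-Complex.I) • (1 + H) := by
      rw [Algebra.algebraMap_eq_smul_one, smul_add, sub_eq_add_neg, neg_smul, neg_smul]
    rw [h'] at h
    have h2 := h.smul (Units.mk0 Complex.I Complex.I_ne_zero)
    rwa [Units.smul_mk0, smul_smul, mul_neg, Complex.I_mul_I, neg_neg, one_smul] at h2
  have := hsa.mem_spectrum_eq_re hmem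
  have him := congrArg Complex.im this
  simp at him

theorem norm_inverse_one_add_le {H : EllTwo →L[ℂ] EllTwo} (hH : H ∈ skewAdjoint _) :
    ‖Ring.inverse (1 + H)‖ ≤ 1 := by
  refine ContinuousLinearMap.opNorm_le_bound _ zero_le_one fun v => ?_
  rw [one_mul]
  refine (norm_le_norm_one_add_apply hH _).trans (le_of_eq ?_)
  rw [← mul_apply_eq_comp, Ring.mul_inverse_cancel _ (isUnit_one_add hH),
    one_apply_eq_self]

/-- Real kernels that are odd give skew-adjoint convolutions. -/
theorem smul_shift_sub_mem_skewAdjoint (r : ℝ) (n : ℤ) :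
    (r : ℂ) • (shift n - shift (-n)) ∈ skewAdjoint (EllTwo →L[ℂ] EllTwo) := by
  rw [skewAdjoint.mem_iff, star_smul, star_sub, ContinuousLinearMap.star_eq_adjoint,
    ContinuousLinearMap.star_eq_adjoint, adjoint_shift, adjoint_shift, neg_neg, ← smul_neg, neg_sub]
  simp

/-! ### Differences of the points `⌊n ^ α⌋` -/

theorem exists_rpow_sub_rpow_eq {a b : ℝ} (p : ℝ) (ha : 0 < a) (hab : a < b) :
    ∃ c, a < c ∧ c < b ∧ b ^ p - a ^ p = p * c ^ (p - 1) * (b - a) := by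
  obtain ⟨c, hc, h⟩ := exists_hasDerivAt_eq_slope (fun t : ℝ => t ^ p)
    (fun t => p * t ^ (p - 1)) hab
    (fun t ht => (Real.continuousAt_rpow_const t p
      (Or.inl (ha.trans_le ht.1).ne')).continuousWithinAt)
    (fun t ht => Real.hasDerivAt_rpow_const (Or.inl (ha.trans ht.1).ne'))
  refine ⟨c, hc.1, hc.2, ?_⟩
  rw [h, div_mul_cancel₀ _ (sub_pos.mpr hab).ne']

theorem le_rpow_sub_rpow {α a b : ℝ} (hα : 1 < α) (ha : 0 < a) (hab : a < b) :
    a ^ (α - 1) * (b - a) ≤ b ^ α - a ^ α := by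
  obtain ⟨c, hac, -, h⟩ := exists_rpow_sub_rpow_eq α ha hab
  rw [h]
  have h1 : a ^ (α - 1) ≤ c ^ (α - 1) :=
    Real.rpow_le_rpow ha.le hac.le (by linarith)
  have h2 : 0 ≤ a ^ (α - 1) := Real.rpow_nonneg ha.le _
  refine mul_le_mul_of_nonneg_right ?_ (by linarith)
  nlinarith

theorem rpow_sub_rpow_le {α a b : ℝ} (hα : 1 < α) (ha : 0 < a) (hab : a < b) :
    b ^ α - a ^ α ≤ α * b ^ (α - 1) * (b - a) := by
  obtain ⟨c, hac, hcb, h⟩ := exists_rpow_sub_rpow_eq α ha hab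
  rw [h]
  have h1 : c ^ (α - 1) ≤ b ^ (α - 1) :=
    Real.rpow_le_rpow (ha.trans hac).le hcb.le (by linarith)
  exact mul_le_mul_of_nonneg_right (mul_le_mul_of_nonneg_left h1 (by linarith)) (by linarith)

/-- The differences `(t + k) ^ α - t ^ α` increase in `t` at a rate controlled from below. -/
theorem le_rpow_sub_rpow_sub {α a b k T : ℝ} (hα : 1 < α) (hα2 : α ≤ 3 / 2) (ha : 0 < a)
    (hab : a < b) (hk : 0 < k) (hT : b + k ≤ T) :
    α * (α - 1) * k * T ^ (α - 2) * (b - a) ≤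
      ((b + k) ^ α - b ^ α) - ((a + k) ^ α - a ^ α) := by
  obtain ⟨c, hc, h⟩ := exists_hasDerivAt_eq_slope (fun t : ℝ => (t + k) ^ α - t ^ α)
    (fun t => α * (t + k) ^ (α - 1) - α * t ^ (α - 1)) hab
    (fun t ht => by
      have h0 : 0 < t := ha.trans_le ht.1
      refine ContinuousAt.continuousWithinAt (ContinuousAt.sub ?_ ?_)
      · exact (continuousAt_id.add continuousAt_const).rpow_const (Or.inl (by simp; positivity))
      · exact Real.continuousAt_rpow_const t α (Or.inl h0.ne'))
    (fun t ht => by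
      have h0 : 0 < t := ha.trans ht.1
      have h1 := (Real.hasDerivAt_rpow_const (p := α)
        (Or.inl (add_pos h0 hk).ne')).comp_add_const t k
      exact h1.sub (Real.hasDerivAt_rpow_const (Or.inl h0.ne')))
  have hc0 : 0 < c := ha.trans hc.1
  obtain ⟨d, hcd, hdc, hd⟩ := exists_rpow_sub_rpow_eq (α - 1) hc0 (lt_add_of_pos_right c hk)
  have hd0 : 0 < d := hc0.trans hcd
  have hTd : T ^ (α - 2) ≤ d ^ (α - 2) :=
    Real.rpow_le_rpow_of_nonpos hd0 (by linarith [hc.2]) (by linarith)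
  rw [eq_div_iff (sub_pos.mpr hab).ne'] at h
  rw [← h]
  refine mul_le_mul_of_nonneg_right ?_ (sub_pos.mpr hab).le
  have h2 : α - 1 - 1 = α - 2 := by ring
  rw [h2, add_sub_cancel_left] at hd
  rw [← mul_sub, hd]
  have h3 : 0 ≤ α * (α - 1) * k := by
    have : 0 < α - 1 := by linarith
    positivity
  nlinarith [mul_le_mul_of_nonneg_left hTd h3]

/-- The integer part of `n ^ α`. -/
noncomputable def pt (α : ℝ) (n : ℕ) : ℤ := ⌊(n : ℝ) ^ α⌋

theorem pt_strictMono {α : ℝ} (hα : 1 < α) : StrictMono (pt α) := by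
  refine strictMono_nat_of_lt_succ fun n => ?_
  have h := Real.add_rpow_le_rpow_add (Nat.cast_nonneg n) (zero_le_one' ℝ) hα.le
  rw [Real.one_rpow] at h
  rw [pt, pt, ← Int.add_one_le_iff, Int.le_floor]
  push_cast
  linarith [Int.floor_le ((n : ℝ) ^ α)]

theorem lt_two_mul_pt {α X : ℝ} (hα : 1 < α) (hX : 1 ≤ X) {n : ℕ} (hn : X ≤ n) : X < 2 * (pt α n : ℝ) := by
  have h1 : X ≤ (n : ℝ) ^ α :=
    hn.trans (Real.self_le_rpow_of_one_le (hX.trans hn) hα.le)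
  have h2 : (n : ℝ) ^ α < pt α n + 1 := Int.lt_floor_add_one _
  have h3 : (1 : ℤ) ≤ pt α n := Int.le_floor.mpr (by push_cast; linarith)
  have h4 : (1 : ℝ) ≤ pt α n := by exact_mod_cast h3
  linarith

/-- The natural numbers in `[X, K * X]`. -/
noncomputable def window (X K : ℝ) : Finset ℕ := Finset.Icc ⌈X⌉₊ ⌊K * X⌋₊

theorem mem_window {X K : ℝ} (hX : 1 ≤ X) (hK : 1 ≤ K) {n : ℕ} :
    n ∈ window X K ↔ X ≤ n ∧ (n : ℝ) ≤ K * X := by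
  rw [window, Finset.mem_Icc, Nat.ceil_le, Nat.le_floor_iff (by positivity)]

theorem card_window_le {X K : ℝ} (hX : 1 ≤ X) (hK : 1 ≤ K) : ((window X K).card : ℝ) ≤ K * X := by
  have h1 : 1 ≤ ⌈X⌉₊ := Nat.one_le_ceil_iff.mpr (by linarith)
  have h2 : (window X K).card ≤ ⌊K * X⌋₊ := by
    rw [window, Nat.card_Icc]
    omega
  exact (Nat.cast_le.mpr h2).trans (Nat.floor_le (by positivity))

/-- A finite set of natural numbers of diameter at most `D` has at most `D + 1` elements. -/
theorem card_le_of_forall_sub_le (s : Finset ℕ) {D : ℝ} (hD : 0 ≤ D)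
    (h : ∀ m ∈ s, ∀ n ∈ s, m < n → (n : ℝ) - m ≤ D) : (s.card : ℝ) ≤ 1 + D := by
  rcases s.eq_empty_or_nonempty with rfl | hs
  · simp
    linarith
  have hsub : s ⊆ Finset.Icc (s.min' hs) (s.max' hs) := fun n hn =>
    Finset.mem_Icc.mpr ⟨s.min'_le n hn, s.le_max' n hn⟩
  have hcard := Finset.card_le_card hsub
  rw [Nat.card_Icc] at hcard
  have hle : s.min' hs ≤ s.max' hs := s.min'_le _ (s.max'_mem hs)
  have hcard' : (s.card : ℝ) ≤ (s.max' hs : ℝ) + 1 - s.min' hs := by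
    rw [le_sub_iff_add_le]
    exact_mod_cast (by omega : s.card + s.min' hs ≤ s.max' hs + 1)
  rcases hle.eq_or_lt with heq | hlt
  · rw [heq] at hcard'
    linarith
  · linarith [h _ (s.min'_mem hs) _ (s.max'_mem hs) hlt]

/-- For `1 ≤ x ≤ X` the number of solutions of `⌊n' ^ α⌋ - ⌊n ^ α⌋ = x` in the window `[X, K X]`
is at most what equidistribution predicts: the difference `k = n' - n` takes `O(x / X ^ (α - 1))`
values, all of that order, and for given `k` the numbers `n` lie in an interval of length
`O(X ^ (2 - α) / k)`. -/
theorem exists_card_pairs_le {α K : ℝ} (hα : 1 < α) (hα2 : α ≤ 3 / 2) (hK : 1 ≤ K) :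
    ∃ C : ℝ, 0 ≤ C ∧ ∀ X : ℝ, 1 ≤ X → ∀ x : ℤ, 1 ≤ x → (x : ℝ) ≤ X →
      (((window X K ×ˢ window X K).filter fun p => pt α p.2 - pt α p.1 = x).card : ℝ) ≤
        C * X ^ (2 - α) := by
  have hα0 : 0 < α * (α - 1) := mul_pos (by linarith) (by linarith)
  set E : ℝ := 6 * K ^ 2 / (α * (α - 1)) with hE
  have hE0 : 0 ≤ E := by positivity
  refine ⟨2 + 2 * E, by positivity, fun X hX x hx1 hxX => ?_⟩
  have hX0 : 0 < X := by linarith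
  have hx1' : (1 : ℝ) ≤ x := by exact_mod_cast hx1
  have hx0 : (0 : ℝ) < x := by linarith
  -- `k * X ^ (α - 1) ≤ (n + k) ^ α - n ^ α ≤ x + 1 ≤ 2 * x` bounds the difference `k`
  set kmax : ℕ := ⌊2 * x * X ^ (1 - α)⌋₊ with hkmax
  set F : ℕ → Finset ℕ := fun k =>
    (window X K).filter fun n => n + k ∈ window X K ∧ pt α (n + k) - pt α n = x with hF
  have hFmem : ∀ k n, 1 ≤ k → n ∈ F k → X ≤ n ∧ (n : ℝ) + k ≤ K * X ∧
      (x : ℝ) - 1 < ((n : ℝ) + k) ^ α - (n : ℝ) ^ α ∧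
      ((n : ℝ) + k) ^ α - (n : ℝ) ^ α < x + 1 := by
    intro k n _ hn
    obtain ⟨h1, h2, h3⟩ := Finset.mem_filter.mp hn
    rw [mem_window hX hK] at h1 h2
    push_cast at h2
    have h4 : (pt α (n + k) : ℝ) - pt α n = x := by exact_mod_cast h3
    have h5 := Int.floor_le (((n + k : ℕ) : ℝ) ^ α)
    have h6 := Int.lt_floor_add_one (((n + k : ℕ) : ℝ) ^ α)
    have h7 := Int.floor_le ((n : ℝ) ^ α)
    have h8 := Int.lt_floor_add_one ((n : ℝ) ^ α)
    rw [pt, pt] at h4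
    push_cast at h4 h5 h6
    exact ⟨h1.1, h2.2, by linarith, by linarith⟩
  have hXpow : X ^ (α - 1) * X ^ (1 - α) = 1 := by
    rw [← Real.rpow_add hX0]
    simp
  have hXpow' : X ^ (1 - α) * X = X ^ (2 - α) := by
    rw [← Real.rpow_add_one hX0.ne']
    congr 1
    ring
  have hFcard : ∀ k, 1 ≤ k → ((F k).card : ℝ) ≤ 1 + E * (X / x) := by
    intro k hk
    have hk0 : (0 : ℝ) < k := by exact_mod_cast hk
    refine card_le_of_forall_sub_le _ (by positivity) fun m hm n hn hmn => ?_
    obtain ⟨hm1, hm2, hm3, hm4⟩ := hFmem k m hk hm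
    obtain ⟨hn1, hn2, hn3, hn4⟩ := hFmem k n hk hn
    have hmn' : (m : ℝ) < n := by exact_mod_cast hmn
    have hrate := le_rpow_sub_rpow_sub hα hα2 (hX0.trans_le hm1) hmn' hk0 hn2
    have hup := rpow_sub_rpow_le hα (hX0.trans_le hm1) (lt_add_of_pos_right (m : ℝ) hk0)
    rw [add_sub_cancel_left] at hup
    have hKX1 : 1 ≤ K * X := one_le_mul_of_one_le_of_one_le hK hX
    have hKX : (0 : ℝ) < K * X := by linarith
    have h1 : ((m : ℝ) + k) ^ (α - 1) ≤ (K * X) ^ (α - 1) :=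
      Real.rpow_le_rpow (by positivity) hm2 (by linarith)
    have h2 : 1 ≤ (K * X) ^ (α - 1) := Real.one_le_rpow hKX1 (by linarith)
    have hk1 : (1 : ℝ) ≤ k := by exact_mod_cast hk
    -- the shift `k` cannot be small compared with `x`
    have h3 : (x : ℝ) ≤ 3 * k * (K * X) ^ (α - 1) := by
      have h4 : α * ((m : ℝ) + k) ^ (α - 1) * k ≤ 3 / 2 * (K * X) ^ (α - 1) * k := by
        gcongr
      have h5 : (k : ℝ) ≤ (K * X) ^ (α - 1) * k := le_mul_of_one_le_left hk0.le h2
      linarith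
    have h5 : (K * X) ^ (α - 2) * (K * X) = (K * X) ^ (α - 1) := by
      rw [← Real.rpow_add_one hKX.ne']
      congr 1
      ring
    have h6 : 0 < (K * X) ^ (α - 2) := Real.rpow_pos_of_pos hKX _
    have h7 : α * (α - 1) * k * (K * X) ^ (α - 2) * ((n : ℝ) - m) ≤ 2 := by linarith
    have h8 : α * (α - 1) * x * ((n : ℝ) - m) ≤ 6 * (K * X) := by
      have hnm : 0 ≤ α * (α - 1) * ((n : ℝ) - m) := by
        have : 0 < (n : ℝ) - m := by linarith
        positivity
      rw [← h5] at h3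
      have h9 := mul_le_mul_of_nonneg_right h3 hnm
      have h10 := mul_le_mul_of_nonneg_left h7 (by positivity : 0 ≤ 3 * (K * X))
      linarith
    have h11 : E * (X / x) = 6 * K ^ 2 * X / (α * (α - 1) * x) := by
      rw [hE]
      field_simp
    rw [h11, le_div_iff₀ (by positivity)]
    have h12 : K * X ≤ K ^ 2 * X := mul_le_mul_of_nonneg_right (le_self_pow₀ hK two_ne_zero) hX0.le
    rw [mul_comm]
    linarith
  have hcard : ((window X K ×ˢ window X K).filter fun p => pt α p.2 - pt α p.1 = x).card ≤
      ((Finset.Icc 1 kmax).sigma F).card := by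
    refine Finset.card_le_card_of_injOn (fun p => ⟨p.2 - p.1, p.1⟩) ?_ ?_
    · rintro ⟨m, n⟩ hp
      obtain ⟨hmn, hx⟩ := Finset.mem_filter.mp (Finset.mem_coe.mp hp)
      obtain ⟨hm, hn⟩ := Finset.mem_product.mp hmn
      dsimp only at hm hn hx
      have hlt : m < n := (pt_strictMono hα).lt_iff_lt.mp (by omega)
      have hnm : m + (n - m) = n := by omega
      have hmem : m ∈ F (n - m) := by
        rw [hF]
        refine Finset.mem_filter.mpr ⟨hm, ?_⟩
        rw [hnm]
        exact ⟨hn, hx⟩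
      refine Finset.mem_coe.mpr (Finset.mem_sigma.mpr ⟨Finset.mem_Icc.mpr
        ⟨Nat.sub_pos_of_lt hlt, ?_⟩, hmem⟩)
      dsimp only
      obtain ⟨h1, -, -, h4⟩ := hFmem (n - m) m (by omega) hmem
      have hk0 : (0 : ℝ) < ((n - m : ℕ) : ℝ) := by exact_mod_cast (by omega : 0 < n - m)
      have h5 := le_rpow_sub_rpow hα (hX0.trans_le h1) (lt_add_of_pos_right (m : ℝ) hk0)
      rw [add_sub_cancel_left] at h5
      have h6 : X ^ (α - 1) ≤ (m : ℝ) ^ (α - 1) := Real.rpow_le_rpow hX0.le h1 (by linarith)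
      have h7 : X ^ (α - 1) * ((n - m : ℕ) : ℝ) ≤ 2 * x := by
        have := mul_le_mul_of_nonneg_right h6 hk0.le
        linarith
      refine Nat.le_floor ?_
      have h8 := mul_le_mul_of_nonneg_right h7 (Real.rpow_nonneg hX0.le (1 - α))
      calc ((n - m : ℕ) : ℝ) = (X ^ (α - 1) * X ^ (1 - α)) * ((n - m : ℕ) : ℝ) := by
            rw [hXpow, one_mul]
        _ ≤ _ := by linarith
    · rintro ⟨m, n⟩ hp ⟨m', n'⟩ hp' heq
      obtain ⟨-, hx⟩ := Finset.mem_filter.mp (Finset.mem_coe.mp hp)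
      obtain ⟨-, hx'⟩ := Finset.mem_filter.mp (Finset.mem_coe.mp hp')
      simp only [Sigma.mk.injEq, heq_eq_eq] at heq
      dsimp only at hx hx'
      obtain ⟨-, rfl⟩ := heq
      have : pt α n = pt α n' := by omega
      rw [(pt_strictMono hα).injective this]
  calc _ ≤ (((Finset.Icc 1 kmax).sigma F).card : ℝ) := by exact_mod_cast hcard
    _ = ∑ k ∈ Finset.Icc 1 kmax, ((F k).card : ℝ) := by
      rw [Finset.card_sigma]
      push_cast
      rfl
    _ ≤ ∑ k ∈ Finset.Icc 1 kmax, (1 + E * (X / x)) :=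
      Finset.sum_le_sum fun k hk => hFcard k (Finset.mem_Icc.mp hk).1
    _ = kmax * (1 + E * (X / x)) := by simp [mul_add]
    _ ≤ (2 * x * X ^ (1 - α)) * (1 + E * (X / x)) := by
      gcongr
      exact Nat.floor_le (by positivity)
    _ = 2 * x * X ^ (1 - α) + 2 * E * (X ^ (1 - α) * X) := by
      field_simp
    _ ≤ 2 * X * X ^ (1 - α) + 2 * E * (X ^ (1 - α) * X) := by gcongr
    _ = (2 + 2 * E) * X ^ (2 - α) := by
      rw [← hXpow']
      ring

/-- The points `± ⌊n ^ α⌋` with `n` in the window `[X, K X]`. -/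
noncomputable def ptSet (α X K : ℝ) : Finset ℤ :=
  (window X K).image (pt α) ∪ (window X K).image fun n => -pt α n

theorem mem_ptSet {α X K : ℝ} {y : ℤ} :
    y ∈ ptSet α X K ↔ ∃ n ∈ window X K, y = pt α n ∨ y = -pt α n := by
  simp only [ptSet, Finset.mem_union, Finset.mem_image]
  constructor
  · rintro (⟨n, hn, rfl⟩ | ⟨n, hn, rfl⟩)
    exacts [⟨n, hn, Or.inl rfl⟩, ⟨n, hn, Or.inr rfl⟩]
  · rintro ⟨n, hn, rfl | rfl⟩
    exacts [Or.inl ⟨n, hn, rfl⟩, Or.inr ⟨n, hn, rfl⟩]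

theorem card_ptSet_le {α X K : ℝ} (hX : 1 ≤ X) (hK : 1 ≤ K) :
    ((ptSet α X K).card : ℝ) ≤ 2 * K * X := by
  have h1 : (ptSet α X K).card ≤ (window X K).card + (window X K).card :=
    (Finset.card_union_le _ _).trans (add_le_add Finset.card_image_le Finset.card_image_le)
  have h2 : ((ptSet α X K).card : ℝ) ≤ (window X K).card + (window X K).card := by
    exact_mod_cast h1
  linarith [card_window_le hX hK]

theorem abs_le_of_mem_ptSet {α X K : ℝ} (hα : 1 < α) (hX : 1 ≤ X) (hK : 1 ≤ K) {y : ℤ}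
    (hy : y ∈ ptSet α X K) : |(y : ℝ)| ≤ (K * X) ^ α := by
  obtain ⟨n, hn, h⟩ := mem_ptSet.mp hy
  have h1 : |(y : ℝ)| = pt α n := by
    have h0 : (0 : ℝ) ≤ pt α n := by
      exact_mod_cast Int.floor_nonneg.mpr (Real.rpow_nonneg (Nat.cast_nonneg n) α)
    rcases h with rfl | rfl
    · exact abs_of_nonneg h0
    · push_cast
      rw [abs_neg, abs_of_nonneg h0]
  rw [h1]
  exact (Int.floor_le _).trans (Real.rpow_le_rpow (Nat.cast_nonneg n)
    ((mem_window hX hK).mp hn).2 (by linarith))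

theorem exists_card_filter_ptSet_le {α K : ℝ} (hα : 1 < α) (hα2 : α ≤ 3 / 2) (hK : 1 ≤ K) :
    ∃ C : ℝ, 0 ≤ C ∧ ∀ X : ℝ, 1 ≤ X → ∀ x : ℤ, x ≠ 0 → |(x : ℝ)| ≤ X →
      (((ptSet α X K).filter fun y => y + x ∈ ptSet α X K).card : ℝ) ≤ C * X ^ (2 - α) := by
  obtain ⟨C, hC, h⟩ := exists_card_pairs_le hα hα2 hK
  refine ⟨2 * C, by positivity, fun X hX x hx0 hxX => ?_⟩
  have hpos : ∀ x : ℤ, 0 < x → (x : ℝ) ≤ X →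
      (((ptSet α X K).filter fun y => y + x ∈ ptSet α X K).card : ℝ) ≤
        2 * C * X ^ (2 - α) := by
    intro x hx hxX
    set R := (window X K ×ˢ window X K).filter fun p => pt α p.2 - pt α p.1 = x with hR
    have hsub : ((ptSet α X K).filter fun y => y + x ∈ ptSet α X K) ⊆
        R.image (fun p => pt α p.1) ∪ R.image (fun p => -pt α p.2) := by
      intro y hy
      obtain ⟨hy1, hy2⟩ := Finset.mem_filter.mp hy
      obtain ⟨m, hm, hm'⟩ := mem_ptSet.mp hy1
      obtain ⟨n, hn, hn'⟩ := mem_ptSet.mp hy2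
      have hmX := lt_two_mul_pt hα hX ((mem_window hX hK).mp hm).1
      have hnX := lt_two_mul_pt hα hX ((mem_window hX hK).mp hn).1
      have hmn : x < pt α m + pt α n := by
        have : (x : ℝ) < pt α m + pt α n := by linarith
        exact_mod_cast this
      rw [Finset.mem_union, Finset.mem_image, Finset.mem_image]
      rcases hm' with rfl | rfl <;> rcases hn' with h' | h'
      · exact Or.inl ⟨(m, n), Finset.mem_filter.mpr
          ⟨Finset.mem_product.mpr ⟨hm, hn⟩, by dsimp only; omega⟩, rfl⟩
      · omega
      · omega
      · exact Or.inr ⟨(n, m), Finset.mem_filter.mpr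
          ⟨Finset.mem_product.mpr ⟨hn, hm⟩, by dsimp only; omega⟩, rfl⟩
    have h1 := (Finset.card_le_card hsub).trans
      ((Finset.card_union_le _ _).trans (add_le_add Finset.card_image_le Finset.card_image_le))
    have h2 : (((ptSet α X K).filter fun y => y + x ∈ ptSet α X K).card : ℝ) ≤
        R.card + R.card := by exact_mod_cast h1
    have h3 := h X hX x (by omega) hxX
    linarith
  rcases lt_or_gt_of_ne hx0 with hneg | hgt
  · have h1 := hpos (-x) (by omega) (by push_cast; linarith [neg_le_abs (x : ℝ)])
    refine le_trans ?_ h1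
    rw [Nat.cast_le]
    refine Finset.card_le_card_of_injOn (fun y => y + x) ?_ (add_left_injective x).injOn
    intro y hy
    obtain ⟨hy1, hy2⟩ := Finset.mem_filter.mp (Finset.mem_coe.mp hy)
    refine Finset.mem_coe.mpr (Finset.mem_filter.mpr ⟨hy2, ?_⟩)
    rwa [add_neg_cancel_right]
  · exact hpos x hgt ((le_abs_self _).trans hxX)

/-! ### Square function estimates for products of kernels -/

theorem sum_norm_ptSet_le {α X K D : ℝ} (hX : 1 ≤ X) (hK : 1 ≤ K) (hD : 0 ≤ D) {κ : ℤ → ℂ}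
    (hκ : ∀ y ∈ ptSet α X K, ‖κ y‖ ≤ D / X) : ∑ y ∈ ptSet α X K, ‖κ y‖ ≤ 2 * K * D := by
  have hX0 : 0 < X := by linarith
  refine (Finset.sum_le_card_nsmul _ _ _ hκ).trans ?_
  rw [nsmul_eq_mul]
  calc _ ≤ 2 * K * X * (D / X) := by
        gcongr
        exact card_ptSet_le hX hK
    _ = 2 * K * D := by field_simp

theorem sum_norm_sq_ptSet_le {α X K D : ℝ} (hX : 1 ≤ X) (hK : 1 ≤ K) {κ : ℤ → ℂ}
    (hκ : ∀ y ∈ ptSet α X K, ‖κ y‖ ≤ D / X) :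
    ∑ y ∈ ptSet α X K, ‖κ y‖ ^ 2 ≤ 2 * K * D ^ 2 / X := by
  have hX0 : 0 < X := by linarith
  refine (Finset.sum_le_card_nsmul _ _ ((D / X) ^ 2) fun y hy =>
    pow_le_pow_left₀ (norm_nonneg _) (hκ y hy) 2).trans ?_
  rw [nsmul_eq_mul]
  calc _ ≤ 2 * K * X * (D / X) ^ 2 := by
        gcongr
        exact card_ptSet_le hX hK
    _ = 2 * K * D ^ 2 / X := by field_simp

/-- A kernel of size `1 / X` on the points `± ⌊n ^ α⌋`, `n ∼ X`, has correlations of the size of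
those of a smooth density at all nonzero distances up to `X`. -/
theorem exists_norm_inner_shift_le {α K : ℝ} (hα : 1 < α) (hα2 : α ≤ 3 / 2) (hK : 1 ≤ K)
    (D : ℝ) :
    ∃ C : ℝ, 0 ≤ C ∧ ∀ X : ℝ, 1 ≤ X → ∀ κ : ℤ → ℂ, (∀ y ∈ ptSet α X K, ‖κ y‖ ≤ D / X) →
      ∀ x : ℤ, x ≠ 0 → |(x : ℝ)| ≤ X →
        ‖inner ℂ (shift x (conv (ptSet α X K) κ delta)) (conv (ptSet α X K) κ delta)‖ ≤
          C * X ^ (-α) := by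
  obtain ⟨C, hC, h⟩ := exists_card_filter_ptSet_le hα hα2 hK
  refine ⟨D ^ 2 * C, by positivity, fun X hX κ hκ x hx0 hxX => ?_⟩
  have hX0 : 0 < X := by linarith
  refine (norm_inner_shift_conv_delta_le _ κ hκ x).trans ?_
  calc _ ≤ (D / X) ^ 2 * (C * X ^ (2 - α)) := by
        gcongr
        exact h X hX x hx0 hxX
    _ = D ^ 2 * C * X ^ (-α) := by
        rw [sub_eq_add_neg, Real.rpow_add hX0, Real.rpow_two]
        field_simp

/-- Pairs of points of `s` in a common block `[jX, (j + 1)X)` are at distance less than `X`. -/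
theorem sum_card_block_sq_le (s : Finset ℤ) {X R : ℝ} (hX : 1 ≤ X) (hR : 0 ≤ R)
    (h : ∀ x : ℤ, x ≠ 0 → |(x : ℝ)| ≤ X → ((s.filter fun y => y + x ∈ s).card : ℝ) ≤ R) :
    ∑ j ∈ s.image (fun y : ℤ => ⌊(y : ℝ) / X⌋),
      ((s.filter fun y : ℤ => ⌊(y : ℝ) / X⌋ = j).card : ℝ) ^ 2 ≤ s.card + 3 * X * R := by
  classical
  have hX0 : 0 < X := by linarith
  set β : ℤ → ℤ := fun y : ℤ => ⌊(y : ℝ) / X⌋ with hβ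
  set m : ℤ := ⌊X⌋ with hm
  have hm0 : 0 ≤ m := Int.floor_nonneg.mpr hX0.le
  have h1 : ∑ j ∈ s.image β, (s.filter fun y => β y = j).card ^ 2 =
      ((s ×ˢ s).filter fun p => β p.1 = β p.2).card := by
    rw [Finset.card_eq_sum_card_fiberwise (f := fun p => β p.1) (t := s.image β)]
    · refine Finset.sum_congr rfl fun j _ => ?_
      rw [sq, ← Finset.card_product]
      congr 1
      ext ⟨y, z⟩
      simp only [Finset.mem_product, Finset.mem_filter]
      constructor
      · rintro ⟨⟨hy, rfl⟩, hz, hz'⟩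
        exact ⟨⟨⟨hy, hz⟩, hz'.symm⟩, rfl⟩
      · rintro ⟨⟨⟨hy, hz⟩, hz'⟩, rfl⟩
        exact ⟨⟨hy, rfl⟩, hz, hz'.symm⟩
    · intro p hp
      exact Finset.mem_coe.mpr (Finset.mem_image_of_mem _
        (Finset.mem_product.mp (Finset.mem_filter.mp (Finset.mem_coe.mp hp)).1).1)
  have h2 : ((s ×ˢ s).filter fun p => β p.1 = β p.2).card ≤
      ∑ x ∈ Finset.Icc (-m) m, (s.filter fun y => y + x ∈ s).card := by
    rw [← Finset.card_sigma]
    refine Finset.card_le_card_of_injOn (fun p => ⟨p.2 - p.1, p.1⟩) ?_ ?_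
    · rintro ⟨y, z⟩ hp
      obtain ⟨hyz, heq⟩ := Finset.mem_filter.mp (Finset.mem_coe.mp hp)
      obtain ⟨hy, hz⟩ := Finset.mem_product.mp hyz
      dsimp only at hy hz heq
      have habs := Int.abs_sub_lt_one_of_floor_eq_floor heq
      rw [← sub_div, abs_div, abs_of_pos hX0, div_lt_one hX0, abs_lt] at habs
      refine Finset.mem_coe.mpr (Finset.mem_sigma.mpr ⟨Finset.mem_Icc.mpr ⟨?_, ?_⟩,
        Finset.mem_filter.mpr ⟨hy, by simpa using hz⟩⟩)
      · dsimp only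
        rw [neg_le, hm, Int.le_floor]
        push_cast
        linarith
      · dsimp only
        rw [hm, Int.le_floor]
        push_cast
        linarith
    · rintro ⟨y, z⟩ - ⟨y', z'⟩ - heq
      simp only [Sigma.mk.injEq, heq_eq_eq] at heq
      obtain ⟨h1, rfl⟩ := heq
      simpa using h1
  have h3 : ∀ x ∈ Finset.Icc (-m) m, ((s.filter fun y => y + x ∈ s).card : ℝ) ≤
      (if x = 0 then (s.card : ℝ) else 0) + R := by
    intro x hx
    split_ifs with h0
    · have : (s.filter fun y => y + x ∈ s).card ≤ s.card := Finset.card_filter_le _ _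
      have : ((s.filter fun y => y + x ∈ s).card : ℝ) ≤ s.card := by exact_mod_cast this
      linarith
    · rw [zero_add]
      refine h x h0 ?_
      obtain ⟨hx1, hx2⟩ := Finset.mem_Icc.mp hx
      have h4 : |x| ≤ m := abs_le.mpr ⟨hx1, hx2⟩
      have h5 : |(x : ℝ)| ≤ m := by exact_mod_cast h4
      exact h5.trans (Int.floor_le X)
  have h4 : (∑ j ∈ s.image β, ((s.filter fun y => β y = j).card : ℝ) ^ 2) ≤
      ∑ x ∈ Finset.Icc (-m) m, ((s.filter fun y => y + x ∈ s).card : ℝ) := by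
    exact_mod_cast h1.le.trans h2
  refine h4.trans ((Finset.sum_le_sum h3).trans ?_)
  rw [Finset.sum_add_distrib, Finset.sum_ite_eq' , if_pos (Finset.mem_Icc.mpr ⟨by omega, hm0⟩),
    Finset.sum_const, nsmul_eq_mul, Int.card_Icc]
  have h5 : (((m + 1 - -m).toNat : ℕ) : ℝ) = 2 * (m : ℝ) + 1 := by
    have : (((m + 1 - -m).toNat : ℕ) : ℤ) = 2 * m + 1 := by
      rw [Int.toNat_of_nonneg (by omega)]
      ring
    exact_mod_cast this
  rw [h5]
  have h6 : (m : ℝ) ≤ X := Int.floor_le X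
  have h7 : 2 * (m : ℝ) + 1 ≤ 3 * X := by linarith
  linarith [mul_le_mul_of_nonneg_right h7 hR]

theorem card_image_block_le {α X K : ℝ} (hα : 1 < α) (hX : 1 ≤ X) (hK : 1 ≤ K) :
    (((ptSet α X K).image fun y : ℤ => ⌊(y : ℝ) / X⌋).card : ℝ) ≤ 5 * K ^ α * X ^ (α - 1) := by
  have hX0 : 0 < X := by linarith
  set Z : ℝ := K ^ α * X ^ (α - 1) with hZ
  have hZ' : Z = (K * X) ^ α / X := by
    rw [hZ, Real.mul_rpow (by linarith) hX0.le, Real.rpow_sub_one hX0.ne']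
    ring
  have hZ1 : 1 ≤ Z := one_le_mul_of_one_le_of_one_le (Real.one_le_rpow hK (by linarith))
    (Real.one_le_rpow hX (by linarith))
  have hsub : ((ptSet α X K).image fun y : ℤ => ⌊(y : ℝ) / X⌋) ⊆
      Finset.Icc (-⌈Z⌉) ⌈Z⌉ := by
    intro j hj
    obtain ⟨y, hy, rfl⟩ := Finset.mem_image.mp hj
    have h1 : |(y : ℝ) / X| ≤ Z := by
      rw [abs_div, abs_of_pos hX0, hZ']
      gcongr
      exact abs_le_of_mem_ptSet hα hX hK hy
    obtain ⟨h2, h3⟩ := abs_le.mp h1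
    refine Finset.mem_Icc.mpr ⟨?_, ?_⟩
    · rw [Int.le_floor]
      push_cast
      linarith [Int.le_ceil Z]
    · exact_mod_cast (Int.floor_le _).trans (h3.trans (Int.le_ceil Z))
  have hcard := Finset.card_le_card hsub
  rw [Int.card_Icc] at hcard
  have hZ0 : 0 ≤ ⌈Z⌉ := Int.ceil_nonneg (by linarith)
  have h5 : (((⌈Z⌉ + 1 - -⌈Z⌉).toNat : ℕ) : ℝ) = 2 * (⌈Z⌉ : ℝ) + 1 := by
    have : (((⌈Z⌉ + 1 - -⌈Z⌉).toNat : ℕ) : ℤ) = 2 * ⌈Z⌉ + 1 := by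
      rw [Int.toNat_of_nonneg (by omega)]
      ring
    exact_mod_cast this
  have h6 : (((ptSet α X K).image fun y : ℤ => ⌊(y : ℝ) / X⌋).card : ℝ) ≤ 2 * (⌈Z⌉ : ℝ) + 1 := by
    rw [← h5]
    exact_mod_cast hcard
  have h7 := Int.ceil_lt_add_one Z
  linarith

set_option maxHeartbeats 1000000 in
/-- The square of a kernel of size `1 / X` on the points `± ⌊n ^ α⌋`, `n ∼ X`, has the `ℓ²` size
of a density `1 / X ^ α` on `O(X ^ α)` points. Only correlations at distances up to `X` are under
control, so the first factor is cut into `O(X ^ (α - 1))` blocks of length `X`. -/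
theorem exists_norm_conv_sq_delta_sq_le {α K : ℝ} (hα : 1 < α) (hα2 : α ≤ 3 / 2) (hK : 1 ≤ K)
    (D : ℝ) :
    ∃ C : ℝ, 0 ≤ C ∧ ∀ X : ℝ, 1 ≤ X → ∀ κ : ℤ → ℂ, (∀ y ∈ ptSet α X K, ‖κ y‖ ≤ D / X) →
      ‖conv (ptSet α X K) κ (conv (ptSet α X K) κ delta)‖ ^ 2 ≤ C * X ^ (-α) := by
  classical
  obtain ⟨C₁, hC₁, hcorr⟩ := exists_norm_inner_shift_le hα hα2 hK D
  obtain ⟨C₂, hC₂, hcount⟩ := exists_card_filter_ptSet_le hα hα2 hK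
  refine ⟨5 * K ^ α * ((2 * K * D ^ 2) ^ 2 + C₁ * D ^ 2 * (2 * K + 3 * C₂)), by positivity,
    fun X hX κ hκ => ?_⟩
  have hX0 : 0 < X := by linarith
  set s := ptSet α X K with hs
  set v := conv s κ delta with hv
  set β : ℤ → ℤ := fun y : ℤ => ⌊(y : ℝ) / X⌋ with hβ
  set J := s.image β with hJ
  set blk : ℤ → Finset ℤ := fun j => s.filter fun y => β y = j with hblk
  have hmaps : ∀ y ∈ s, β y ∈ J := fun y hy => Finset.mem_image_of_mem _ hy
  have hblkmem : ∀ j, ∀ y ∈ blk j, y ∈ s ∧ β y = j := fun j y hy => Finset.mem_filter.mp hy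
  have hsplit : conv s κ v = ∑ j ∈ J, conv (blk j) κ v := by
    rw [← sum_apply]
    congr 1
    exact (Finset.sum_fiberwise_of_maps_to hmaps _).symm
  have hpow0 : 0 ≤ X ^ (-α) := Real.rpow_nonneg hX0.le _
  have hvsq : ‖v‖ ^ 2 ≤ 2 * K * D ^ 2 / X := by
    rw [hv, norm_conv_delta_sq]
    exact sum_norm_sq_ptSet_le hX hK hκ
  have hone : ∀ j ∈ J, ‖conv (blk j) κ v‖ ^ 2 ≤
      2 * K * D ^ 2 / X * (∑ y ∈ blk j, ‖κ y‖ ^ 2) +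
        C₁ * X ^ (-α) * (D / X) ^ 2 * ((blk j).card : ℝ) ^ 2 := by
    intro j _
    have h1 := norm_conv_apply_sq_le (blk j) κ v (σ := C₁ * X ^ (-α)) (by positivity) (by
      intro y hy z hz hyz
      obtain ⟨-, hy⟩ := hblkmem j y hy
      obtain ⟨-, hz⟩ := hblkmem j z hz
      refine hcorr X hX κ hκ (y - z) (sub_ne_zero.mpr hyz) ?_
      have habs := Int.abs_sub_lt_one_of_floor_eq_floor (hy.trans hz.symm)
      rw [← sub_div, abs_div, abs_of_pos hX0, div_lt_one hX0] at habs
      push_cast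
      exact habs.le)
    have h2 : ∑ y ∈ blk j, ‖κ y‖ ≤ (blk j).card * (D / X) := by
      rw [← nsmul_eq_mul]
      exact Finset.sum_le_card_nsmul _ _ _ fun y hy => hκ y (hblkmem j y hy).1
    have h3 : 0 ≤ ∑ y ∈ blk j, ‖κ y‖ := Finset.sum_nonneg fun y _ => norm_nonneg _
    refine h1.trans (add_le_add ?_ ?_)
    · exact mul_le_mul_of_nonneg_right hvsq (Finset.sum_nonneg fun y _ => by positivity)
    · calc _ ≤ C₁ * X ^ (-α) * ((blk j).card * (D / X)) ^ 2 := by gcongr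
        _ = _ := by ring
  have hXa : X ^ (3 - α) = X * X ^ (2 - α) := by
    rw [mul_comm, ← Real.rpow_add_one hX0.ne']
    congr 1
    ring
  have hblocks : ∑ j ∈ J, ((blk j).card : ℝ) ^ 2 ≤ (2 * K + 3 * C₂) * X ^ (3 - α) := by
    have h1 := sum_card_block_sq_le s hX (R := C₂ * X ^ (2 - α)) (by positivity) (hcount X hX)
    have h2 : X ≤ X ^ (3 - α) := Real.self_le_rpow_of_one_le hX (by linarith)
    have h3 : (s.card : ℝ) ≤ 2 * K * X := card_ptSet_le hX hK
    have h4 : 2 * K * X ≤ 2 * K * X ^ (3 - α) := by gcongr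
    refine h1.trans ?_
    rw [add_mul]
    refine add_le_add (h3.trans h4) (le_of_eq ?_)
    rw [hXa]
    ring
  have hsq : ∑ j ∈ J, ∑ y ∈ blk j, ‖κ y‖ ^ 2 ≤ 2 * K * D ^ 2 / X := by
    rw [Finset.sum_fiberwise_of_maps_to hmaps]
    exact sum_norm_sq_ptSet_le hX hK hκ
  have hJcard : (J.card : ℝ) ≤ 5 * K ^ α * X ^ (α - 1) := card_image_block_le hα hX hK
  have hp1 : X ^ (α - 1) * (2 * K * D ^ 2 / X * (2 * K * D ^ 2 / X)) ≤
      (2 * K * D ^ 2) ^ 2 * X ^ (-α) := by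
    have h1 : X ^ (α - 3) ≤ X ^ (-α) := Real.rpow_le_rpow_of_exponent_le hX (by linarith)
    have h2 : X ^ (α - 1) = X ^ (α - 3) * X ^ 2 := by
      rw [← Real.rpow_two, ← Real.rpow_add hX0]
      congr 1
      ring
    calc _ = (2 * K * D ^ 2) ^ 2 * X ^ (α - 3) := by
          rw [h2]
          field_simp
      _ ≤ _ := by gcongr
  have hp2 : X ^ (α - 1) * (C₁ * X ^ (-α) * (D / X) ^ 2 * ((2 * K + 3 * C₂) * X ^ (3 - α))) =
      C₁ * D ^ 2 * (2 * K + 3 * C₂) * X ^ (-α) := by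
    have h1 : X ^ (α - 1) * X ^ (3 - α) = X ^ 2 := by
      rw [← Real.rpow_two, ← Real.rpow_add hX0]
      congr 1
      ring
    calc _ = C₁ * X ^ (-α) * (D / X) ^ 2 * (2 * K + 3 * C₂) * (X ^ (α - 1) * X ^ (3 - α)) := by
          ring
      _ = _ := by
        rw [h1]
        field_simp
  calc ‖conv s κ v‖ ^ 2 ≤ (∑ j ∈ J, ‖conv (blk j) κ v‖) ^ 2 := by
        rw [hsplit]
        gcongr
        exact norm_sum_le _ _
    _ ≤ J.card * ∑ j ∈ J, ‖conv (blk j) κ v‖ ^ 2 := sq_sum_le_card_mul_sum_sq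
    _ ≤ J.card * (2 * K * D ^ 2 / X * (2 * K * D ^ 2 / X) +
          C₁ * X ^ (-α) * (D / X) ^ 2 * ((2 * K + 3 * C₂) * X ^ (3 - α))) := by
        refine mul_le_mul_of_nonneg_left ((Finset.sum_le_sum hone).trans ?_) (Nat.cast_nonneg _)
        rw [Finset.sum_add_distrib, ← Finset.mul_sum, ← Finset.mul_sum]
        gcongr
    _ ≤ 5 * K ^ α * X ^ (α - 1) * (2 * K * D ^ 2 / X * (2 * K * D ^ 2 / X) +
          C₁ * X ^ (-α) * (D / X) ^ 2 * ((2 * K + 3 * C₂) * X ^ (3 - α))) := by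
        gcongr
    _ = 5 * K ^ α * (X ^ (α - 1) * (2 * K * D ^ 2 / X * (2 * K * D ^ 2 / X)) +
          X ^ (α - 1) * (C₁ * X ^ (-α) * (D / X) ^ 2 * ((2 * K + 3 * C₂) * X ^ (3 - α)))) := by
        ring
    _ ≤ 5 * K ^ α * ((2 * K * D ^ 2) ^ 2 * X ^ (-α) +
          C₁ * D ^ 2 * (2 * K + 3 * C₂) * X ^ (-α)) := by
        rw [hp2]
        gcongr
    _ = _ := by ring

/-- A kernel at the small scale `X`, applied twice to one at a much larger scale `Y`. -/
theorem exists_norm_conv_conv_conv_delta_sq_le {α K : ℝ} (hα : 1 < α) (hα2 : α ≤ 3 / 2)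
    (hK : 1 ≤ K) {D : ℝ} (hD : 0 ≤ D) :
    ∃ C : ℝ, 0 ≤ C ∧ ∀ X Y : ℝ, 1 ≤ X → 1 ≤ Y → 4 * (K * X) ^ α ≤ Y → ∀ κ η : ℤ → ℂ,
      (∀ y ∈ ptSet α X K, ‖κ y‖ ≤ D / X) → (∀ y ∈ ptSet α Y K, ‖η y‖ ≤ D / Y) →
      ‖conv (ptSet α X K) κ (conv (ptSet α X K) κ (conv (ptSet α Y K) η delta))‖ ^ 2 ≤
        C * (X ^ (-α) / Y + Y ^ (-α)) := by
  obtain ⟨C₁, hC₁, hcorr⟩ := exists_norm_inner_shift_le hα hα2 hK D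
  obtain ⟨C₂, hC₂, hsq⟩ := exists_norm_conv_sq_delta_sq_le hα hα2 hK D
  refine ⟨2 * K * D ^ 2 * C₂ + C₁ * ((2 * K * D) ^ 2) ^ 2, by positivity,
    fun X Y hX hY hXY κ η hκ hη => ?_⟩
  have hX0 : 0 < X := by linarith
  have hY0 : 0 < Y := by linarith
  obtain ⟨r, ν, hr, hrmem, hν⟩ := exists_conv_eq_mul (ptSet α X K) (ptSet α X K) κ κ
  rw [← mul_apply_eq_comp, hr]
  have hν2 : ∑ x ∈ r, ‖ν x‖ ^ 2 ≤ C₂ * X ^ (-α) := by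
    rw [← norm_conv_delta_sq, ← hr]
    exact hsq X hX κ hκ
  have hν1 : ∑ x ∈ r, ‖ν x‖ ≤ (2 * K * D) ^ 2 := by
    refine hν.trans ?_
    rw [← sq]
    exact pow_le_pow_left₀ (Finset.sum_nonneg fun y _ => norm_nonneg _)
      (sum_norm_ptSet_le hX hK hD hκ) 2
  have hv : ‖conv (ptSet α Y K) η delta‖ ^ 2 ≤ 2 * K * D ^ 2 / Y := by
    rw [norm_conv_delta_sq]
    exact sum_norm_sq_ptSet_le hY hK hη
  have h := norm_conv_apply_sq_le r ν (conv (ptSet α Y K) η delta) (σ := C₁ * Y ^ (-α))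
    (by positivity) (by
      intro y hy z hz hyz
      refine hcorr Y hY η hη (y - z) (sub_ne_zero.mpr hyz) ?_
      obtain ⟨y₁, hy₁, y₂, hy₂, rfl⟩ := hrmem y hy
      obtain ⟨z₁, hz₁, z₂, hz₂, rfl⟩ := hrmem z hz
      have h1 := abs_le.mp (abs_le_of_mem_ptSet hα hX hK hy₁)
      have h2 := abs_le.mp (abs_le_of_mem_ptSet hα hX hK hy₂)
      have h3 := abs_le.mp (abs_le_of_mem_ptSet hα hX hK hz₁)
      have h4 := abs_le.mp (abs_le_of_mem_ptSet hα hX hK hz₂)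
      push_cast
      exact abs_le.mpr ⟨by linarith, by linarith⟩)
  have hXn : 0 ≤ X ^ (-α) := Real.rpow_nonneg hX0.le _
  have hYn : 0 ≤ Y ^ (-α) := Real.rpow_nonneg hY0.le _
  have hr0 : 0 ≤ ∑ x ∈ r, ‖ν x‖ := Finset.sum_nonneg fun y _ => norm_nonneg _
  calc _ ≤ 2 * K * D ^ 2 / Y * (C₂ * X ^ (-α)) + C₁ * Y ^ (-α) * ((2 * K * D) ^ 2) ^ 2 :=
        h.trans (by gcongr)
    _ = 2 * K * D ^ 2 * C₂ * (X ^ (-α) / Y) + C₁ * ((2 * K * D) ^ 2) ^ 2 * Y ^ (-α) := by ring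
    _ ≤ (2 * K * D ^ 2 * C₂ + C₁ * ((2 * K * D) ^ 2) ^ 2) * (X ^ (-α) / Y) +
        (2 * K * D ^ 2 * C₂ + C₁ * ((2 * K * D) ^ 2) ^ 2) * Y ^ (-α) := by
        gcongr
        · exact le_add_of_nonneg_right (by positivity)
        · exact le_add_of_nonneg_left (by positivity)
    _ = _ := by ring

/-! ### Second order expansion of the resolvent -/

/-- With `u = (1 + a)⁻¹` and `T = (1 + a + b)⁻¹`, this is `T = u - u² b + u² T b²` with the
expansion `u² = 1 - 2 a + (3 + 2 a) u² a²` inserted in the term linear in `b`. -/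
theorem two_mul_mul_eq_of_commute {R : Type*} [Ring R] {a b : R} (hab : Commute a b)
    (hp : IsUnit (1 + a)) (hq : IsUnit (1 + (a + b))) :
    2 * (a * b) = Ring.inverse (1 + (a + b)) - Ring.inverse (1 + a) + b +
      (3 + 2 * a) * (Ring.inverse (1 + a) * Ring.inverse (1 + a)) * (a * (a * b)) -
      Ring.inverse (1 + a) * Ring.inverse (1 + a) * Ring.inverse (1 + (a + b)) * (b * b) := by
  set u := Ring.inverse (1 + a) with hu
  set T := Ring.inverse (1 + (a + b)) with hT
  have hup : u * (1 + a) = 1 := Ring.inverse_mul_cancel _ hp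
  have hpu : (1 + a) * u = 1 := Ring.mul_inverse_cancel _ hp
  have hTq : T * (1 + (a + b)) = 1 := Ring.inverse_mul_cancel _ hq
  have hqT : (1 + (a + b)) * T = 1 := Ring.mul_inverse_cancel _ hq
  have hua : u * a = 1 - u := by
    rw [mul_add, mul_one] at hup
    exact eq_sub_of_add_eq' hup
  have hau : a * u = 1 - u := by
    rw [add_mul, one_mul] at hpu
    exact eq_sub_of_add_eq' hpu
  have hub : u * b = b * u := by
    have h1 : (1 + a) * b = b * (1 + a) := by rw [add_mul, mul_add, hab.eq, one_mul, mul_one]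
    calc u * b = u * (b * (1 + a)) * u := by rw [mul_assoc, mul_assoc, hpu, mul_one]
      _ = u * (1 + a) * b * u := by rw [← h1, ← mul_assoc]
      _ = b * u := by rw [hup, one_mul]
  have hTb : T * b = b * T := by
    have h1 : (1 + (a + b)) * b = b * (1 + (a + b)) := by
      rw [add_mul, mul_add, add_mul, mul_add, hab.eq, one_mul, mul_one]
    calc T * b = T * (b * (1 + (a + b))) * T := by rw [mul_assoc, mul_assoc, hqT, mul_one]
      _ = T * (1 + (a + b)) * b * T := by rw [← h1, ← mul_assoc]
      _ = b * T := by rw [hTq, one_mul]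
  have hT1 : T = u - u * b * T := by
    have h1 : u * (1 + (a + b)) = 1 + u * b := by rw [← add_assoc, mul_add, hup]
    have h2 : u = (1 + u * b) * T := by rw [← h1, mul_assoc, hqT, mul_one]
    rw [add_mul, one_mul] at h2
    exact eq_sub_of_add_eq h2.symm
  have hT2 : T = u - u * u * b + u * u * T * (b * b) := by
    have h1 : u * b * T = u * u * b - u * u * T * (b * b) := by
      conv_lhs => rw [hT1]
      rw [mul_sub]
      congr 1
      · rw [mul_assoc, ← hub, mul_assoc]
      · calc u * b * (u * b * T) = u * (b * u) * (b * T) := by simp only [mul_assoc]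
          _ = u * u * (b * T) * b := by rw [← hub, ← hTb]; simp only [mul_assoc, hTb]
          _ = u * u * T * (b * b) := by rw [← hTb]; simp only [mul_assoc]
    conv_lhs => rw [hT1, h1]
    abel
  have hu2 : u * u * (a * a) = 1 - 2 * u + u * u := by
    calc u * u * (a * a) = u * (u * a) * a := by simp only [mul_assoc]
      _ = u * a - u * (u * a) := by rw [hua, mul_sub, mul_one, sub_mul, mul_assoc, hua, mul_sub, mul_one]
      _ = 1 - 2 * u + u * u := by rw [hua, mul_sub, mul_one, two_mul]; abel
  have hauu : a * (u * u) = u - u * u := by rw [← mul_assoc, hau, sub_mul, one_mul]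
  have h3 : (3 + 2 * a) * (u * u) * (a * a) = 2 * a - 1 + u * u := by
    have h6 : a * (1 - 2 * u + u * u) = a - ((1 - u) + (1 - u)) + (u - u * u) := by
      rw [mul_add, mul_sub, two_mul, mul_add, hauu, hau, mul_one]
    rw [mul_assoc, hu2, add_mul, mul_assoc 2 a, h6]
    noncomm_ring
  have h4 : (3 + 2 * a) * (u * u) * (a * (a * b)) = (2 * a - 1 + u * u) * b := by
    rw [← h3]
    simp only [mul_assoc]
  rw [h4, add_mul, sub_mul, one_mul, ← mul_assoc]
  have h5 : u * u * T * (b * b) = T - u + u * u * b := by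
    conv_rhs => rw [hT2]
    abel
  rw [h5]
  abel

/-- Where the product `a b` is large, one of the other terms of the expansion is: the two
resolvents are controlled by their weak type bounds, `b` by its support and the others in `ℓ²`. -/
theorem card_mul_sq_le_of_weakTypeBound {a : EllTwo →L[ℂ] EllTwo} {s : Finset ℤ} {η : ℤ → ℂ}
    (hab : Commute a (conv s η)) (ha : a ∈ skewAdjoint (EllTwo →L[ℂ] EllTwo))
    (hb : conv s η ∈ skewAdjoint (EllTwo →L[ℂ] EllTwo)) {C : ℝ≥0}
    (hu : WeakTypeBound (Ring.inverse (1 + a)) C)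
    (hT : WeakTypeBound (Ring.inverse (1 + (a + conv s η))) C)
    (G : Finset ℤ) {t : ℝ} (ht : 0 < t) (hG : ∀ x ∈ G, 5 * t < 2 * ‖a (conv s η delta) x‖) :
    (G.card : ℝ) * t ^ 2 ≤ 2 * C * t + s.card * t ^ 2 +
      (3 + 2 * ‖a‖) ^ 2 * ‖a (a (conv s η delta))‖ ^ 2 + ‖conv s η (conv s η delta)‖ ^ 2 := by
  classical
  set b := conv s η with hbdef
  have hid := two_mul_mul_eq_of_commute hab (isUnit_one_add ha)
    (isUnit_one_add ((skewAdjoint _).add_mem ha hb))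
  have hu1 := norm_inverse_one_add_le ha
  have hT1 := norm_inverse_one_add_le ((skewAdjoint _).add_mem ha hb)
  set u := Ring.inverse (1 + a) with hudef
  set T := Ring.inverse (1 + (a + b)) with hTdef
  set W := (3 + 2 * a) * (u * u) with hW
  have hWn : ‖W‖ ≤ 3 + 2 * ‖a‖ := by
    have h1 : ‖(3 + 2 * a : EllTwo →L[ℂ] EllTwo)‖ ≤ 3 + 2 * ‖a‖ := by
      have h3 : (3 : EllTwo →L[ℂ] EllTwo) = (3 : ℂ) • 1 := by
        rw [← Algebra.algebraMap_eq_smul_one, map_ofNat]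
      have h2 : (2 * a : EllTwo →L[ℂ] EllTwo) = (2 : ℂ) • a := by
        rw [two_mul, two_smul]
      rw [h2, h3]
      refine (norm_add_le _ _).trans (add_le_add ?_ ?_)
      · rw [norm_smul, RCLike.norm_ofNat]
        have : ‖(1 : EllTwo →L[ℂ] EllTwo)‖ ≤ 1 := ContinuousLinearMap.norm_id_le
        linarith
      · rw [norm_smul, RCLike.norm_ofNat]
    have h2 : ‖u * u‖ ≤ 1 := (norm_mul_le _ _).trans (mul_le_one₀ hu1 (norm_nonneg _) hu1)
    refine (norm_mul_le _ _).trans ?_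
    calc _ ≤ (3 + 2 * ‖a‖) * 1 := by gcongr
      _ = _ := mul_one _
  set V := u * u * T with hV
  have hVn : ‖V‖ ≤ 1 := (norm_mul_le _ _).trans
    (mul_le_one₀ ((norm_mul_le _ _).trans (mul_le_one₀ hu1 (norm_nonneg _) hu1))
      (norm_nonneg _) hT1)
  set E := W (a (a (b delta))) with hE
  set F := V (b (b delta)) with hF
  have hpt : ∀ x, 2 * a (b delta) x = T delta x - u delta x + b delta x + E x - F x := by
    intro x
    have h := congrArg (fun S : EllTwo →L[ℂ] EllTwo => S delta x) hid
    simpa [two_mul] using h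
  -- off the support of `b` one of the four other terms exceeds `t`, as their sum exceeds `5 * t`
  have hcover : G ⊆ (((G.filter fun x => t < ‖T delta x‖) ∪ (G.filter fun x => t < ‖u delta x‖)) ∪
      s) ∪ ((G.filter fun x => t < ‖E x‖) ∪ (G.filter fun x => t < ‖F x‖)) := by
    intro x hx
    by_contra hcon
    simp only [Finset.mem_union, Finset.mem_filter, hx, true_and, not_or, not_lt] at hcon
    obtain ⟨⟨⟨h1, h2⟩, h3⟩, h4, h5⟩ := hcon
    have h6 : b delta x = 0 := by rw [hbdef, conv_delta_apply, if_neg h3]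
    have h7 := hG x hx
    have h8 : 2 * ‖a (b delta) x‖ = ‖T delta x - u delta x + E x - F x‖ := by
      have h9 := hpt x
      rw [h6, add_zero] at h9
      rw [← h9, norm_mul, RCLike.norm_ofNat]
    have h9 := norm_sub_le (T delta x - u delta x + E x) (F x)
    have h10 := norm_add_le (T delta x - u delta x) (E x)
    have h11 := norm_sub_le (T delta x) (u delta x)
    linarith
  have hcard : (G.card : ℝ) ≤ (G.filter fun x => t < ‖T delta x‖).card +
      (G.filter fun x => t < ‖u delta x‖).card + s.card +
      ((G.filter fun x => t < ‖E x‖).card + (G.filter fun x => t < ‖F x‖).card) := by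
    have h1 := (Finset.card_le_card hcover).trans ((Finset.card_union_le _ _).trans
      (add_le_add ((Finset.card_union_le _ _).trans (add_le_add (Finset.card_union_le _ _) le_rfl))
        (Finset.card_union_le _ _)))
    exact_mod_cast h1
  have k1 := hT.card_mul_le (G.filter fun x => t < ‖T delta x‖) ht.le
    fun x hx => (Finset.mem_filter.mp hx).2
  have k2 := hu.card_mul_le (G.filter fun x => t < ‖u delta x‖) ht.le
    fun x hx => (Finset.mem_filter.mp hx).2
  have k3 := card_mul_sq_le_norm_sq E (G.filter fun x => t < ‖E x‖) ht.le
    fun x hx => (Finset.mem_filter.mp hx).2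
  have k4 := card_mul_sq_le_norm_sq F (G.filter fun x => t < ‖F x‖) ht.le
    fun x hx => (Finset.mem_filter.mp hx).2
  have hE2 : ‖E‖ ^ 2 ≤ (3 + 2 * ‖a‖) ^ 2 * ‖a (a (b delta))‖ ^ 2 := by
    rw [← mul_pow]
    exact pow_le_pow_left₀ (norm_nonneg _) (W.le_of_opNorm_le hWn _) 2
  have hF2 : ‖F‖ ^ 2 ≤ ‖b (b delta)‖ ^ 2 := by
    refine pow_le_pow_left₀ (norm_nonneg _) ((V.le_of_opNorm_le hVn _).trans ?_) 2
    rw [one_mul]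
  have k5 := mul_le_mul_of_nonneg_right hcard (sq_nonneg t)
  have k6 := mul_le_mul_of_nonneg_right k1 ht.le
  have k7 := mul_le_mul_of_nonneg_right k2 ht.le
  nlinarith

/-! ### Sums of points at two scales -/

/-- Outside a small set of exceptional pairs the sums `y + z`, `y ∈ s`, `z ∈ r`, have no other
representation, so that the product kernel is just `κ y * η z` there. -/
theorem exists_unique_sums (s r : Finset ℤ) (κ η : ℤ → ℂ) {R : ℝ}
    (hR : ∀ y ∈ s, ∀ y' ∈ s, y ≠ y' →
      ((r.filter fun z => z + (y - y') ∈ r).card : ℝ) ≤ R) (hR0 : 0 ≤ R)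
    (S : Finset (ℤ × ℤ)) (hS : S ⊆ s ×ˢ r) :
    ∃ G : Finset ℤ, (S.card : ℝ) ≤ G.card + (s.card : ℝ) ^ 2 * R ∧
      ∀ x ∈ G, ∃ p ∈ S, conv s κ (conv r η delta) x = κ p.1 * η p.2 := by
  classical
  set Bad : Finset (ℤ × ℤ) :=
    (s ×ˢ r).filter fun p => ∃ y' ∈ s, y' ≠ p.1 ∧ p.2 + (p.1 - y') ∈ r with hBad
  have hmem : ∀ p ∈ S \ Bad, p.1 ∈ s ∧ p.2 ∈ r ∧ p ∈ S ∧
      ∀ y' ∈ s, y' ≠ p.1 → p.2 + (p.1 - y') ∉ r := by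
    intro p hp
    obtain ⟨h1, h2⟩ := Finset.mem_sdiff.mp hp
    obtain ⟨h3, h4⟩ := Finset.mem_product.mp (hS h1)
    refine ⟨h3, h4, h1, fun y' hy' hne hin => h2 ?_⟩
    exact Finset.mem_filter.mpr ⟨hS h1, y', hy', hne, hin⟩
  have hinj : Set.InjOn (fun p : ℤ × ℤ => p.1 + p.2) (S \ Bad : Finset (ℤ × ℤ)) := by
    intro p hp q hq hpq
    obtain ⟨-, -, -, h4⟩ := hmem p (Finset.mem_coe.mp hp)
    obtain ⟨k1, k2, -, -⟩ := hmem q (Finset.mem_coe.mp hq)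
    dsimp only at hpq
    by_cases h : q.1 = p.1
    · exact Prod.ext h.symm (by omega)
    · exfalso
      refine h4 q.1 k1 h ?_
      have : p.2 + (p.1 - q.1) = q.2 := by omega
      rwa [this]
  refine ⟨(S \ Bad).image fun p => p.1 + p.2, ?_, ?_⟩
  · rw [Finset.card_image_of_injOn hinj]
    have h1 : S.card ≤ (S \ Bad).card + Bad.card := by
      have := Finset.le_card_sdiff Bad S
      omega
    have h2 : (Bad.card : ℝ) ≤ (s.card : ℝ) ^ 2 * R := by
      have hsub : Bad ⊆ ((s ×ˢ s).filter fun q => q.1 ≠ q.2).biUnion fun q =>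
          (r.filter fun z => z + (q.1 - q.2) ∈ r).image fun z => (q.1, z) := by
        intro p hp
        obtain ⟨h1, y', hy', hne, hin⟩ := Finset.mem_filter.mp hp
        obtain ⟨h2, h3⟩ := Finset.mem_product.mp h1
        exact Finset.mem_biUnion.mpr ⟨(p.1, y'), Finset.mem_filter.mpr
          ⟨Finset.mem_product.mpr ⟨h2, hy'⟩, fun h => hne h.symm⟩,
          Finset.mem_image.mpr ⟨p.2, Finset.mem_filter.mpr ⟨h3, hin⟩, rfl⟩⟩
      have h3 : (Bad.card : ℝ) ≤ ∑ q ∈ (s ×ˢ s).filter fun q => q.1 ≠ q.2,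
          ((r.filter fun z => z + (q.1 - q.2) ∈ r).card : ℝ) := by
        exact_mod_cast (Finset.card_le_card hsub).trans (Finset.card_biUnion_le.trans
          (Finset.sum_le_sum fun q _ => Finset.card_image_le))
      refine h3.trans ((Finset.sum_le_card_nsmul _ _ R fun q hq => ?_).trans ?_)
      · obtain ⟨h4, h5⟩ := Finset.mem_filter.mp hq
        obtain ⟨h6, h7⟩ := Finset.mem_product.mp h4
        exact hR q.1 h6 q.2 h7 h5
      · rw [nsmul_eq_mul]
        refine mul_le_mul_of_nonneg_right ?_ hR0
        rw [sq]
        exact_mod_cast (Finset.card_filter_le _ _).trans (Finset.card_product s s).le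
    have h3 : (S.card : ℝ) ≤ (S \ Bad).card + Bad.card := by exact_mod_cast h1
    linarith
  · intro x hx
    obtain ⟨p, hp, rfl⟩ := Finset.mem_image.mp hx
    obtain ⟨h1, h2, h3, h4⟩ := hmem p hp
    refine ⟨p, h3, ?_⟩
    rw [conv_apply, Finset.sum_eq_single_of_mem p.1 h1]
    · rw [conv_delta_apply, add_sub_cancel_left, if_pos h2]
    · intro y' hy' hne
      have h5 : p.1 + p.2 - y' = p.2 + (p.1 - y') := by ring
      rw [conv_delta_apply, h5, if_neg (h4 y' hy' hne), mul_zero]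

/-! ### Consequences of a weak type bound for two distant scales -/

theorem exists_conv_ptSet_eq {α X K D : ℝ} (hα : 1 < α) (hX : 1 ≤ X) (hK : 1 ≤ K)
    (c : ℕ → ℝ) (hc : ∀ m ∈ window X K, |c m| ≤ D / X) :
    ∃ κ : ℤ → ℂ, ∑ m ∈ window X K, (c m : ℂ) • (shift (pt α m) - shift (-pt α m)) =
        conv (ptSet α X K) κ ∧
      (∀ y ∈ ptSet α X K, ‖κ y‖ ≤ D / X) ∧ ∀ m ∈ window X K, κ (pt α m) = c m := by
  classical
  have hpos : ∀ m ∈ window X K, 0 < pt α m := by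
    intro m hm
    have h := lt_two_mul_pt hα hX ((mem_window hX hK).mp hm).1
    have h1 : (0 : ℝ) < pt α m := by linarith
    exact_mod_cast h1
  have hmem1 : ∀ m ∈ window X K, pt α m ∈ ptSet α X K := fun m hm =>
    mem_ptSet.mpr ⟨m, hm, Or.inl rfl⟩
  have hmem2 : ∀ m ∈ window X K, -pt α m ∈ ptSet α X K := fun m hm =>
    mem_ptSet.mpr ⟨m, hm, Or.inr rfl⟩
  set κ : ℤ → ℂ := fun y => ∑ m ∈ window X K,
    ((if pt α m = y then (c m : ℂ) else 0) - if -pt α m = y then (c m : ℂ) else 0) with hκ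
  have hκ1 : ∀ m ∈ window X K, κ (pt α m) = c m := by
    intro m hm
    rw [hκ]
    dsimp only
    rw [Finset.sum_eq_single_of_mem m hm]
    · have := hpos m hm
      rw [if_pos rfl, if_neg (by omega), sub_zero]
    · intro n hn hne
      have h1 := hpos m hm
      have h2 := hpos n hn
      rw [if_neg (fun h => hne ((pt_strictMono hα).injective h)), if_neg (by omega), sub_zero]
  have hκ2 : ∀ m ∈ window X K, κ (-pt α m) = -c m := by
    intro m hm
    rw [hκ]
    dsimp only
    rw [Finset.sum_eq_single_of_mem m hm]
    · have := hpos m hm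
      rw [if_neg (by omega), if_pos rfl, zero_sub]
    · intro n hn hne
      have h1 := hpos m hm
      have h2 := hpos n hn
      rw [if_neg (by omega), if_neg (fun h => hne ((pt_strictMono hα).injective
        (neg_injective h))), sub_zero]
  refine ⟨κ, ?_, ?_, hκ1⟩
  · rw [conv]
    simp only [hκ, Finset.sum_smul]
    rw [Finset.sum_comm]
    refine Finset.sum_congr rfl fun m hm => ?_
    simp only [sub_smul, ite_smul, zero_smul, Finset.sum_sub_distrib]
    rw [Finset.sum_ite_eq, Finset.sum_ite_eq, if_pos (hmem1 m hm), if_pos (hmem2 m hm), smul_sub]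
  · intro y hy
    obtain ⟨m, hm, rfl | rfl⟩ := mem_ptSet.mp hy
    · rw [hκ1 m hm, Complex.norm_real]
      exact hc m hm
    · rw [hκ2 m hm, norm_neg, Complex.norm_real]
      exact hc m hm

/-- The scale `X` of the first kernel is taken so small in terms of the scale `Y` of the second
that the `X Y` sums of their points are sparse in the interval of length `Y ^ α` that contains
them. The number of pairs of points for which the product of the kernels has its full size is then
at most a multiple of `X Y` that does not depend on the bounds `K` and `D` for the kernels. -/
theorem exists_card_le_of_weakTypeBound {α K : ℝ} (hα : 1 < α) (hα2 : α ≤ 3 / 2) (hK : 1 ≤ K)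
    {D : ℝ} (hD : 0 ≤ D) :
    ∃ R ε : ℝ, 1 ≤ R ∧ 0 < ε ∧ ε ≤ 1 ∧ ∀ X Y Q : ℝ, R ≤ X → 1 ≤ Y → X ≤ ε * Y ^ (α - 1) →
      X * Y ≤ Q → Q ≤ K * (X * Y) → ∀ κ η : ℤ → ℂ,
      (∀ y ∈ ptSet α X K, ‖κ y‖ ≤ D / X) → (∀ y ∈ ptSet α Y K, ‖η y‖ ≤ D / Y) →
      conv (ptSet α X K) κ ∈ skewAdjoint (EllTwo →L[ℂ] EllTwo) →
      conv (ptSet α Y K) η ∈ skewAdjoint (EllTwo →L[ℂ] EllTwo) → ∀ C : ℝ≥0,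
      WeakTypeBound (Ring.inverse (1 + conv (ptSet α X K) κ)) C →
      WeakTypeBound (Ring.inverse (1 + (conv (ptSet α X K) κ + conv (ptSet α Y K) η))) C →
      ∀ S ⊆ ptSet α X K ×ˢ ptSet α Y K,
        (∀ p ∈ S, 1 / (4 * Q) ≤ ‖κ p.1 * η p.2‖) → (S.card : ℝ) ≤ (24 * C + 3) * Q := by
  obtain ⟨C₁, hC₁, hcount⟩ := exists_card_filter_ptSet_le hα hα2 hK
  obtain ⟨C₂, hC₂, hbb⟩ := exists_norm_conv_sq_delta_sq_le hα hα2 hK D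
  obtain ⟨C₃, hC₃, haab⟩ := exists_norm_conv_conv_conv_delta_sq_le hα hα2 hK hD
  set C₄ : ℝ := (3 + 2 * (2 * K * D)) ^ 2 * C₃ + C₂ with hC₄
  have hC₄0 : 0 ≤ C₄ := by positivity
  set ε₁ : ℝ := 1 / (288 * K * C₄ + 1) with hε₁
  have hε₁0 : 0 < ε₁ := by positivity
  have hε₁' : 144 * K * C₄ * (2 * ε₁) ≤ 1 := by
    rw [hε₁, ← mul_assoc, mul_one_div, div_le_one (by positivity)]
    linarith
  obtain ⟨R₀, hR₀⟩ : ∃ R₀ : ℝ, ∀ X : ℝ, R₀ ≤ X → X ^ (1 - α) ≤ ε₁ := by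
    have h := tendsto_rpow_neg_atTop (sub_pos.mpr hα)
    rw [neg_sub] at h
    exact Filter.eventually_atTop.mp (h.eventually (eventually_le_nhds hε₁0))
  set ε₂ : ℝ := 1 / (4 * K ^ 2 * C₁ + 1) with hε₂
  have hε₂0 : 0 < ε₂ := by positivity
  have hε₂' : 4 * K ^ 2 * C₁ * ε₂ ≤ 1 := by
    rw [hε₂, mul_one_div, div_le_one (by positivity)]
    linarith
  set ε : ℝ := min (1 / (4 * K)) (min ε₁ ε₂) with hε
  have hε0 : 0 < ε := lt_min (by positivity) (lt_min hε₁0 hε₂0)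
  have hεK : ε ≤ 1 / (4 * K) := min_le_left _ _
  have hεε₁ : ε ≤ ε₁ := (min_le_right _ _).trans (min_le_left _ _)
  have hεε₂ : ε ≤ ε₂ := (min_le_right _ _).trans (min_le_right _ _)
  have hK4 : ε * (4 * K) ≤ 1 := by rwa [← le_div_iff₀ (by positivity)]
  refine ⟨max (2 * K) R₀, ε, le_max_of_le_left (by linarith), hε0, by nlinarith, ?_⟩
  intro X Y Q hRX hY hXY hQ1 hQ2 κ η hκ hη hsa hsb C hu hT S hS hSval
  have hX2K : 2 * K ≤ X := (le_max_left _ _).trans hRX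
  have hX : 1 ≤ X := by linarith
  have hX0 : 0 < X := by linarith
  have hY0 : 0 < Y := by linarith
  have hXY0 : 0 < X * Y := by positivity
  have hQ0 : 0 < Q := by linarith
  have hXα : X ^ (1 - α) ≤ ε₁ := hR₀ X ((le_max_right _ _).trans hRX)
  have hYinv : Y ^ (α - 1) * Y ^ (1 - α) = 1 := by
    rw [← Real.rpow_add hY0]
    simp
  have hXYε : X * Y ^ (1 - α) ≤ ε := by
    have h := mul_le_mul_of_nonneg_right hXY (Real.rpow_nonneg hY0.le (1 - α))
    rwa [mul_assoc, hYinv, mul_one] at h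
  -- the smaller scale does not reach the distance `Y`
  have hfar : 4 * (K * X) ^ α ≤ Y := by
    have h1 : K * X ≤ 1 / 4 * Y ^ (α - 1) := by
      have h2 : 0 ≤ Y ^ (α - 1) := Real.rpow_nonneg hY0.le _
      calc K * X ≤ K * (ε * Y ^ (α - 1)) := by gcongr
        _ = ε * (4 * K) * (1 / 4 * Y ^ (α - 1)) := by ring
        _ ≤ 1 * (1 / 4 * Y ^ (α - 1)) := by gcongr
        _ = _ := one_mul _
    have h2 : (K * X) ^ α ≤ (1 / 4 * Y ^ (α - 1)) ^ α :=
      Real.rpow_le_rpow (by positivity) h1 (by linarith)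
    rw [Real.mul_rpow (by norm_num) (Real.rpow_nonneg hY0.le _), ← Real.rpow_mul hY0.le] at h2
    have h3 : (1 / 4 : ℝ) ^ α ≤ 1 / 4 := by
      have := Real.rpow_le_rpow_of_exponent_ge (by norm_num : (0 : ℝ) < 1 / 4) (by norm_num) hα.le
      rwa [Real.rpow_one] at this
    have h4 : Y ^ ((α - 1) * α) ≤ Y := by
      have := Real.rpow_le_rpow_of_exponent_le hY (by nlinarith : (α - 1) * α ≤ 1)
      rwa [Real.rpow_one] at this
    have h5 : (1 / 4 : ℝ) ^ α * Y ^ ((α - 1) * α) ≤ 1 / 4 * Y := by gcongr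
    linarith
  obtain ⟨G, hG1, hG2⟩ := exists_unique_sums (ptSet α X K) (ptSet α Y K) κ η
    (R := C₁ * Y ^ (2 - α)) (by
      intro y hy y' hy' hne
      refine hcount Y hY (y - y') (sub_ne_zero.mpr hne) ?_
      have h1 := abs_le.mp (abs_le_of_mem_ptSet hα hX hK hy)
      have h2 := abs_le.mp (abs_le_of_mem_ptSet hα hX hK hy')
      have h3 : 0 ≤ (K * X) ^ α := by positivity
      push_cast
      exact abs_le.mpr ⟨by linarith, by linarith⟩) (by positivity) S hS
  -- `2 / (4 * Q)`, the least size of `2 a b` on the good sums, is `6 * t` and so exceeds `5 * t`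
  set t : ℝ := 1 / (12 * Q) with ht
  have ht0 : 0 < t := by positivity
  have htQ : 12 * Q * t = 1 := by rw [ht]; field_simp
  have hmain := card_mul_sq_le_of_weakTypeBound (commute_conv _ _ κ η) hsa hsb hu hT G ht0 (by
    intro x hx
    obtain ⟨p, hp, hpx⟩ := hG2 x hx
    rw [hpx]
    have h1 := hSval p hp
    have h2 : 1 / (4 * Q) = 3 * t := by rw [ht]; field_simp; norm_num
    linarith)
  have hcard_b : ((ptSet α Y K).card : ℝ) ≤ Q := by
    refine (card_ptSet_le hY hK).trans (le_trans ?_ hQ1)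
    gcongr
  have hbad : ((ptSet α X K).card : ℝ) ^ 2 * (C₁ * Y ^ (2 - α)) ≤ Q := by
    have h1 : Y ^ (2 - α) = Y * Y ^ (1 - α) := by
      rw [mul_comm, ← Real.rpow_add_one hY0.ne']
      congr 1
      ring
    have h2 : 0 ≤ Y ^ (1 - α) := Real.rpow_nonneg hY0.le _
    calc _ ≤ (2 * K * X) ^ 2 * (C₁ * Y ^ (2 - α)) := by
          gcongr
          exact card_ptSet_le hX hK
      _ = 4 * K ^ 2 * C₁ * (X * Y ^ (1 - α)) * (X * Y) := by rw [h1]; ring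
      _ ≤ 4 * K ^ 2 * C₁ * ε₂ * (X * Y) := by
          gcongr
          exact hXYε.trans hεε₂
      _ ≤ 1 * (X * Y) := by gcongr
      _ ≤ Q := by linarith
  have hnorm_a : ‖conv (ptSet α X K) κ‖ ≤ 2 * K * D :=
    (norm_conv_le _ _).trans (sum_norm_ptSet_le hX hK hD hκ)
  have herr : (3 + 2 * ‖conv (ptSet α X K) κ‖) ^ 2 *
      ‖conv (ptSet α X K) κ (conv (ptSet α X K) κ (conv (ptSet α Y K) η delta))‖ ^ 2 +
      ‖conv (ptSet α Y K) η (conv (ptSet α Y K) η delta)‖ ^ 2 ≤ Q * t ^ 2 := by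
    have h1 := haab X Y hX hY hfar κ η hκ hη
    have h2 := hbb Y hY η hη
    have h3 : 0 ≤ X ^ (-α) := Real.rpow_nonneg hX0.le _
    have h4 : 0 ≤ Y ^ (-α) := Real.rpow_nonneg hY0.le _
    have h5 : X * Y * (X ^ (-α) / Y + Y ^ (-α)) = X ^ (1 - α) + X * Y ^ (1 - α) := by
      rw [sub_eq_add_neg, Real.rpow_add hX0, Real.rpow_add hY0, Real.rpow_one, Real.rpow_one]
      field_simp
    have h6 : C₄ * (X ^ (-α) / Y + Y ^ (-α)) * (144 * (K * (X * Y))) ≤ 1 := by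
      calc _ = 144 * K * C₄ * (X * Y * (X ^ (-α) / Y + Y ^ (-α))) := by ring
        _ ≤ 144 * K * C₄ * (2 * ε₁) := by
            rw [h5]
            gcongr
            linarith
        _ ≤ 1 := hε₁'
    have h7 : C₄ * (X ^ (-α) / Y + Y ^ (-α)) * (144 * Q) ≤ 1 := le_trans (by gcongr) h6
    have h8 : Q * t ^ 2 = 1 / (144 * Q) := by rw [ht]; field_simp; norm_num
    rw [h8, le_div_iff₀ (by positivity)]
    refine le_trans ?_ h7
    gcongr
    calc _ ≤ (3 + 2 * (2 * K * D)) ^ 2 * (C₃ * (X ^ (-α) / Y + Y ^ (-α))) + C₂ * Y ^ (-α) := by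
          gcongr
      _ ≤ (3 + 2 * (2 * K * D)) ^ 2 * (C₃ * (X ^ (-α) / Y + Y ^ (-α))) +
          C₂ * (X ^ (-α) / Y + Y ^ (-α)) := by
          gcongr
          exact le_add_of_nonneg_left (by positivity)
      _ = _ := by rw [hC₄]; ring
  have h1 : (G.card : ℝ) * t ^ 2 ≤ (24 * C * Q + Q + Q) * t ^ 2 := by
    have h2 : 24 * C * Q * t ^ 2 = 2 * C * t := by
      calc 24 * C * Q * t ^ 2 = 2 * C * t * (12 * Q * t) := by ring
        _ = _ := by rw [htQ, mul_one]
    have h3 := mul_le_mul_of_nonneg_right hcard_b (sq_nonneg t)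
    linarith
  have h2 := le_of_mul_le_mul_right h1 (by positivity)
  linarith

/-! ### The blocks of scales of the truncated transform -/

/-- A smooth bump function on the line, equal to `1` on `[1, 3 / 2]` and supported in
`[3 / 4, 7 / 4]`. -/
noncomputable def bump : ContDiffBump (5 / 4 : ℝ) := ⟨1 / 4, 1 / 2, by norm_num, by norm_num⟩

theorem bump_eq_one {t : ℝ} (h1 : 1 ≤ t) (h2 : t ≤ 3 / 2) : bump t = 1 := by
  refine bump.one_of_mem_closedBall ?_
  rw [Metric.mem_closedBall, Real.dist_eq]
  exact abs_le.mpr ⟨by norm_num [bump]; linarith, by norm_num [bump]; linarith⟩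

theorem tsupport_bump : tsupport bump ⊆ Set.Icc (3 / 4) (7 / 4) := by
  rw [bump.tsupport_eq, Real.closedBall_eq_Icc]
  norm_num [bump]

theorem mem_Icc_of_bump_ne_zero {t : ℝ} (h : bump t ≠ 0) : 3 / 4 ≤ t ∧ t ≤ 7 / 4 :=
  tsupport_bump (subset_tsupport _ h)

theorem hilbertPiece_mem_skewAdjoint (α s : ℝ) (ψ : ℝ → ℝ) :
    hilbertPiece α s (fun t => (ψ t : ℂ)) ∈ skewAdjoint (EllTwo →L[ℂ] EllTwo) := by
  refine finsum_induction (· ∈ skewAdjoint (EllTwo →L[ℂ] EllTwo)) (zero_mem _)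
    (fun _ _ => add_mem) fun m => ?_
  refine finsum_induction (· ∈ skewAdjoint (EllTwo →L[ℂ] EllTwo)) (zero_mem _)
    (fun _ _ => add_mem) fun _ => ?_
  have h := smul_shift_sub_mem_skewAdjoint (ψ ((m : ℝ) ^ α / s) / m) ⌊(m : ℝ) ^ α⌋
  push_cast at h
  exact h

theorem hilbertPiece_zero (α s : ℝ) : hilbertPiece α s (fun _ => 0) = 0 := by
  simp [hilbertPiece]

theorem hilbertPiece_eq_sum {α s : ℝ} {ψ : ℝ → ℂ} {F : Finset ℕ} (hF : ∀ m ∈ F, 0 < m)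
    (h : ∀ m : ℕ, ψ ((m : ℝ) ^ α / s) ≠ 0 → 0 < m → m ∈ F) :
    hilbertPiece α s ψ = ∑ m ∈ F,
      (ψ ((m : ℝ) ^ α / s) / (m : ℂ)) • (shift (pt α m) - shift (-pt α m)) := by
  classical
  rw [hilbertPiece]
  simp only [finsum_eq_if]
  rw [finsum_eq_sum_of_support_subset (s := F)]
  · exact Finset.sum_congr rfl fun m hm => if_pos (hF m hm)
  · intro m hm
    rw [Function.mem_support] at hm
    by_cases hm0 : 0 < m
    · rw [if_pos hm0] at hm
      refine h m (fun h0 => hm ?_) hm0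
      rw [h0, zero_div, zero_smul]
    · exact absurd (if_neg hm0) hm

/-- The lower end of the window that contains all `m` with `m ^ α` in the support of a cutoff at
a scale `2 ^ j`, `j ≥ k`; this is `(2 ^ k / 2) ^ (1 / α)`. -/
noncomputable def lowEnd (α : ℝ) (k : ℕ) : ℝ := (2 : ℝ) ^ (((k : ℝ) - 1) / α)

/-- The number `m` with `m ^ α = 2 ^ j`. -/
noncomputable def root (α : ℝ) (j : ℕ) : ℝ := (2 : ℝ) ^ ((j : ℝ) / α)

theorem root_pos (α : ℝ) (j : ℕ) : 0 < root α j := Real.rpow_pos_of_pos two_pos _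

theorem root_rpow {α : ℝ} (hα : 1 < α) (j : ℕ) : root α j ^ α = 2 ^ j := by
  rw [root, ← Real.rpow_mul zero_le_two, div_mul_cancel₀ _ (by linarith), Real.rpow_natCast]

theorem lowEnd_rpow {α : ℝ} (hα : 1 < α) (k : ℕ) : lowEnd α k ^ α = 2 ^ k / 2 := by
  rw [lowEnd, ← Real.rpow_mul zero_le_two, div_mul_cancel₀ _ (by linarith),
    Real.rpow_sub_one two_ne_zero, Real.rpow_natCast]

theorem lowEnd_pos (α : ℝ) (k : ℕ) : 0 < lowEnd α k := Real.rpow_pos_of_pos two_pos _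

theorem lowEnd_le_root {α : ℝ} (hα : 1 < α) {k j : ℕ} (h : k ≤ j) : lowEnd α k ≤ root α j := by
  refine Real.rpow_le_rpow_of_exponent_le one_le_two ?_
  have : (k : ℝ) ≤ j := by exact_mod_cast h
  gcongr
  linarith

theorem two_pow_mul_lowEnd {α : ℝ} (hα : 1 < α) (N k : ℕ) :
    (2 : ℝ) ^ (k + N) ≤ ((2 : ℝ) ^ (N + 1) * lowEnd α k) ^ α := by
  rw [Real.mul_rpow (by positivity) (lowEnd_pos α k).le, lowEnd_rpow hα]
  have h : (2 : ℝ) ^ (N + 1) ≤ ((2 : ℝ) ^ (N + 1)) ^ α :=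
    Real.self_le_rpow_of_one_le (one_le_pow₀ one_le_two) hα.le
  calc (2 : ℝ) ^ (k + N) = 2 ^ (N + 1) * (2 ^ k / 2) := by ring
    _ ≤ _ := by gcongr

theorem mem_window_of_bump_ne_zero {α : ℝ} (hα : 1 < α) {N k i m : ℕ} (hi : i < N)
    (hX : 1 ≤ lowEnd α k) (h : bump ((m : ℝ) ^ α / 2 ^ (k + i)) ≠ 0) :
    m ∈ window (lowEnd α k) (2 ^ (N + 1)) := by
  have hα0 : 0 < α := by linarith
  obtain ⟨h1, h2⟩ := mem_Icc_of_bump_ne_zero h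
  rw [le_div_iff₀ (by positivity)] at h1
  rw [div_le_iff₀ (by positivity)] at h2
  rw [mem_window hX (one_le_pow₀ one_le_two),
    ← Real.rpow_le_rpow_iff (lowEnd_pos α k).le (Nat.cast_nonneg m) hα0,
    ← Real.rpow_le_rpow_iff (Nat.cast_nonneg m)
      (mul_nonneg (by positivity) (lowEnd_pos α k).le) hα0, lowEnd_rpow hα]
  have h3 : (2 : ℝ) ^ k ≤ 2 ^ (k + i) := pow_le_pow_right₀ one_le_two (by omega)
  have h4 : 2 * (2 : ℝ) ^ (k + i) ≤ 2 ^ (k + N) := by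
    rw [mul_comm, ← pow_succ]
    exact pow_le_pow_right₀ one_le_two (by omega)
  have h5 : (0 : ℝ) < 2 ^ (k + i) := by positivity
  exact ⟨by linarith, le_trans (by linarith) (two_pow_mul_lowEnd hα N k)⟩

theorem bump_eq_one_of_mem_window {α : ℝ} (hα : 1 < α) (hα2 : α ≤ 3 / 2) {j m : ℕ}
    (hm1 : root α j ≤ m) (hm2 : (m : ℝ) ≤ 6 / 5 * root α j) :
    bump ((m : ℝ) ^ α / 2 ^ j) = 1 := by
  have h0 := root_pos α j
  have hj : (0 : ℝ) < 2 ^ j := by positivity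
  refine bump_eq_one ?_ ?_
  · rw [le_div_iff₀ hj, one_mul, ← root_rpow hα]
    exact Real.rpow_le_rpow h0.le hm1 (by linarith)
  · rw [div_le_iff₀ hj, ← root_rpow hα]
    refine (Real.rpow_le_rpow (Nat.cast_nonneg m) hm2 (by linarith)).trans ?_
    rw [Real.mul_rpow (by norm_num) h0.le]
    have h1 : (6 / 5 : ℝ) ^ α ≤ 3 / 2 := by
      refine (Real.rpow_le_rpow_of_exponent_le (by norm_num) (by linarith : α ≤ 2)).trans ?_
      rw [Real.rpow_two]
      norm_num
    have h2 : 0 ≤ root α j ^ α := Real.rpow_nonneg h0.le _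
    gcongr

/-- The sum of the single scale operators over `N` consecutive scales is a convolution whose
kernel has size at most `N / X` on the points `± ⌊m ^ α⌋`, and the expected size `m⁻¹` where one
of the cutoffs is `1`. -/
theorem exists_conv_eq_sum_hilbertPiece {α : ℝ} (hα : 1 < α) (hα2 : α ≤ 3 / 2) (N k : ℕ)
    (hX : 1 ≤ lowEnd α k) :
    ∃ κ : ℤ → ℂ, ∑ i ∈ Finset.range N, hilbertPiece α (2 ^ (k + i)) (fun t => (bump t : ℂ)) =
        conv (ptSet α (lowEnd α k) (2 ^ (N + 1))) κ ∧
      (∀ y ∈ ptSet α (lowEnd α k) (2 ^ (N + 1)), ‖κ y‖ ≤ N / lowEnd α k) ∧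
      ∀ i < N, ∀ m ∈ window (root α (k + i)) (6 / 5),
        pt α m ∈ ptSet α (lowEnd α k) (2 ^ (N + 1)) ∧
        1 / (2 * root α (k + i)) ≤ ‖κ (pt α m)‖ := by
  have hK : (1 : ℝ) ≤ 2 ^ (N + 1) := one_le_pow₀ one_le_two
  have hX0 := lowEnd_pos α k
  set W := window (lowEnd α k) (2 ^ (N + 1)) with hW
  set c : ℕ → ℝ := fun m => ∑ i ∈ Finset.range N, bump ((m : ℝ) ^ α / 2 ^ (k + i)) / m with hc
  have hWm : ∀ m ∈ W, lowEnd α k ≤ m := fun m hm => ((mem_window hX hK).mp hm).1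
  have hc0 : ∀ m ∈ W, |c m| ≤ N / lowEnd α k := by
    intro m hm
    have h1 : ∀ i ∈ Finset.range N, |bump ((m : ℝ) ^ α / 2 ^ (k + i)) / m| ≤ 1 / lowEnd α k := by
      intro i _
      have h2 : (0 : ℝ) < m := hX0.trans_le (hWm m hm)
      rw [abs_div, abs_of_pos h2, abs_of_nonneg bump.nonneg]
      exact div_le_div₀ zero_le_one bump.le_one hX0 (hWm m hm)
    refine (Finset.abs_sum_le_sum_abs _ _).trans ((Finset.sum_le_card_nsmul _ _ _ h1).trans ?_)
    rw [Finset.card_range, nsmul_eq_mul, mul_one_div]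
  obtain ⟨κ, h1, h2, h3⟩ := exists_conv_ptSet_eq hα hX hK c hc0
  refine ⟨κ, ?_, h2, ?_⟩
  · rw [← h1]
    have h4 : ∀ i ∈ Finset.range N, hilbertPiece α (2 ^ (k + i)) (fun t => (bump t : ℂ)) =
        ∑ m ∈ W, ((bump ((m : ℝ) ^ α / 2 ^ (k + i)) : ℂ) / (m : ℂ)) •
          (shift (pt α m) - shift (-pt α m)) := by
      intro i hi
      refine hilbertPiece_eq_sum (fun m hm => ?_) fun m hm _ => ?_
      · have := hX0.trans_le (hWm m hm)
        exact_mod_cast this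
      · exact mem_window_of_bump_ne_zero hα (Finset.mem_range.mp hi) hX (by exact_mod_cast hm)
    rw [Finset.sum_congr rfl h4, Finset.sum_comm]
    refine Finset.sum_congr rfl fun m _ => ?_
    rw [← Finset.sum_smul, hc]
    push_cast
    rfl
  · intro i hi m hm
    have hr0 := root_pos α (k + i)
    have hr : lowEnd α k ≤ root α (k + i) := lowEnd_le_root hα (by omega)
    obtain ⟨hm1, hm2⟩ := (mem_window (hX.trans hr) (by norm_num)).mp hm
    have hb := bump_eq_one_of_mem_window hα hα2 hm1 hm2
    have hmW : m ∈ W := mem_window_of_bump_ne_zero hα hi hX (by rw [hb]; exact one_ne_zero)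
    refine ⟨mem_ptSet.mpr ⟨m, hmW, Or.inl rfl⟩, ?_⟩
    have hm0 : (0 : ℝ) < m := hr0.trans_le hm1
    have h5 : 1 / (m : ℝ) ≤ c m := by
      have h6 := Finset.single_le_sum (f := fun i => bump ((m : ℝ) ^ α / 2 ^ (k + i)) / (m : ℝ))
        (fun j _ => div_nonneg bump.nonneg hm0.le) (Finset.mem_range.mpr hi)
      rwa [hb] at h6
    rw [h3 m hmW, Complex.norm_real]
    refine le_trans ?_ (h5.trans (le_abs_self _))
    exact one_div_le_one_div_of_le hm0 (by linarith)

theorem le_card_window {Y : ℝ} (hY : 10 ≤ Y) : Y / 10 ≤ ((window Y (6 / 5)).card : ℝ) := by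
  rw [window, Nat.card_Icc]
  have h1 := Nat.ceil_lt_add_one (by linarith : 0 ≤ Y)
  have h2 := Nat.lt_floor_add_one (6 / 5 * Y)
  have h3 : ((⌊6 / 5 * Y⌋₊ + 1 : ℕ) : ℝ) - ⌈Y⌉₊ ≤ ((⌊6 / 5 * Y⌋₊ + 1 - ⌈Y⌉₊ : ℕ) : ℝ) := by
    rw [sub_le_iff_le_add]
    exact_mod_cast (by omega : ⌊6 / 5 * Y⌋₊ + 1 ≤ ⌊6 / 5 * Y⌋₊ + 1 - ⌈Y⌉₊ + ⌈Y⌉₊)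
  push_cast at h3
  linarith

theorem eq_of_mem_window_root {α : ℝ} (hα : 1 < α) (hα2 : α ≤ 3 / 2) {i j m : ℕ}
    (hi : m ∈ window (root α i) (6 / 5)) (hj : m ∈ window (root α j) (6 / 5)) : i = j := by
  have hroot : ∀ i, 1 ≤ root α i := fun i =>
    Real.one_le_rpow one_le_two (by positivity)
  have key : ∀ i j : ℕ, m ∈ window (root α i) (6 / 5) → m ∈ window (root α j) (6 / 5) →
      ¬ i < j := by
    intro i j hi hj hij
    obtain ⟨-, h1⟩ := (mem_window (hroot i) (by norm_num)).mp hi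
    obtain ⟨h2, -⟩ := (mem_window (hroot j) (by norm_num)).mp hj
    have h3 : (2 : ℝ) ^ i * 2 ≤ 2 ^ j := by
      rw [← pow_succ]
      exact pow_le_pow_right₀ one_le_two hij
    have h4 : (2 : ℝ) ^ j ≤ (6 / 5 * root α i) ^ α := by
      rw [← root_rpow hα]
      exact Real.rpow_le_rpow (root_pos α j).le (h2.trans h1) (by linarith)
    rw [Real.mul_rpow (by norm_num) (root_pos α i).le, root_rpow hα] at h4
    have h5 : (6 / 5 : ℝ) ^ α ≤ 3 / 2 := by
      refine (Real.rpow_le_rpow_of_exponent_le (by norm_num) (by linarith : α ≤ 2)).trans ?_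
      rw [Real.rpow_two]
      norm_num
    have h6 : (0 : ℝ) < 2 ^ i := by positivity
    nlinarith
  have h1 := key i j hi hj
  have h2 := key j i hj hi
  omega

/-- Pairing the scale `2 ^ (k + i)` with `2 ^ (l + (N - 1 - i))` keeps the product of the scales
fixed. This gives `N` disjoint families of pairs on which the product kernel has comparable
size. -/
theorem exists_pairs {α : ℝ} (hα : 1 < α) (hα2 : α ≤ 3 / 2) {N k l : ℕ} (hN : 1 ≤ N)
    (hk : 10 ≤ lowEnd α k) (hl : 10 ≤ lowEnd α l) :
    ∃ S : Finset (ℤ × ℤ), (N : ℝ) * root α (k + l + (N - 1)) / 100 ≤ S.card ∧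
      ∀ p ∈ S, ∃ i < N, ∃ j < N, root α (k + i) * root α (l + j) = root α (k + l + (N - 1)) ∧
        ∃ m ∈ window (root α (k + i)) (6 / 5), ∃ n ∈ window (root α (l + j)) (6 / 5),
          p = (pt α m, pt α n) := by
  classical
  set B : ℕ → Finset (ℕ × ℕ) := fun i =>
    window (root α (k + i)) (6 / 5) ×ˢ window (root α (l + (N - 1 - i))) (6 / 5) with hB
  have hprod : ∀ i < N, root α (k + i) * root α (l + (N - 1 - i)) = root α (k + l + (N - 1)) := by
    intro i hi
    rw [root, root, root, ← Real.rpow_add two_pos, ← add_div]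
    congr 2
    exact_mod_cast (by omega : k + i + (l + (N - 1 - i)) = k + l + (N - 1))
  have hdisj : Set.PairwiseDisjoint (Finset.range N : Set ℕ) B := by
    intro i _ j _ hij
    refine Finset.disjoint_left.mpr fun p hp hq => hij ?_
    have := eq_of_mem_window_root hα hα2 (Finset.mem_product.mp hp).1 (Finset.mem_product.mp hq).1
    omega
  have hinj : Function.Injective (fun p : ℕ × ℕ => (pt α p.1, pt α p.2)) := by
    rintro ⟨m, n⟩ ⟨m', n'⟩ h
    simp only [Prod.mk.injEq] at h
    exact Prod.ext ((pt_strictMono hα).injective h.1) ((pt_strictMono hα).injective h.2)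
  refine ⟨((Finset.range N).biUnion B).image fun p => (pt α p.1, pt α p.2), ?_, ?_⟩
  · rw [Finset.card_image_of_injective _ hinj, Finset.card_biUnion hdisj]
    push_cast
    have h1 : ∀ i ∈ Finset.range N, root α (k + l + (N - 1)) / 100 ≤ ((B i).card : ℝ) := by
      intro i hi
      have h2 := le_card_window (hk.trans (lowEnd_le_root hα (by omega : k ≤ k + i)))
      have h3 := le_card_window (hl.trans (lowEnd_le_root hα (by omega : l ≤ l + (N - 1 - i))))
      rw [hB, Finset.card_product, ← hprod i (Finset.mem_range.mp hi)]
      push_cast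
      have h4 := mul_le_mul h2 h3 (by have := root_pos α (l + (N - 1 - i)); positivity)
        (Nat.cast_nonneg _)
      linarith
    have h2 := Finset.card_nsmul_le_sum _ _ _ h1
    rw [Finset.card_range, nsmul_eq_mul] at h2
    linarith
  · intro p hp
    obtain ⟨q, hq, rfl⟩ := Finset.mem_image.mp hp
    obtain ⟨i, hi, hq⟩ := Finset.mem_biUnion.mp hq
    obtain ⟨h1, h2⟩ := Finset.mem_product.mp hq
    have hi := Finset.mem_range.mp hi
    exact ⟨i, hi, N - 1 - i, by omega, hprod i hi, q.1, h1, q.2, h2, rfl⟩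

/-- A common weak type bound for the two resolvents bounds the number `N` of scales in the
blocks, provided that the blocks are far apart. -/
theorem exists_natCast_le_of_weakTypeBound {α : ℝ} (hα : 1 < α) (hα2 : α ≤ 3 / 2) {N : ℕ}
    (hN : 1 ≤ N) :
    ∃ R ε : ℝ, 0 < ε ∧ ∀ k l : ℕ, R ≤ lowEnd α k → k ≤ l →
      lowEnd α k ≤ ε * lowEnd α l ^ (α - 1) → ∀ C : ℝ≥0,
      WeakTypeBound (Ring.inverse (1 + ∑ i ∈ Finset.range N,
        hilbertPiece α (2 ^ (k + i)) (fun t => (bump t : ℂ)))) C →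
      WeakTypeBound (Ring.inverse (1 + (∑ i ∈ Finset.range N,
        hilbertPiece α (2 ^ (k + i)) (fun t => (bump t : ℂ)) + ∑ i ∈ Finset.range N,
        hilbertPiece α (2 ^ (l + i)) (fun t => (bump t : ℂ))))) C →
      (N : ℝ) ≤ 100 * (24 * C + 3) := by
  have hK : (1 : ℝ) ≤ 2 ^ (N + 1) := one_le_pow₀ one_le_two
  obtain ⟨R, ε, -, hε0, -, hmain⟩ :=
    exists_card_le_of_weakTypeBound hα hα2 hK (D := (N : ℝ)) (Nat.cast_nonneg N)
  refine ⟨max R 10, ε, hε0, fun k l hRk hkl hε C hu hT => ?_⟩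
  have hk : 10 ≤ lowEnd α k := (le_max_right _ _).trans hRk
  have hl : 10 ≤ lowEnd α l := by
    refine hk.trans (Real.rpow_le_rpow_of_exponent_le one_le_two ?_)
    have : (k : ℝ) ≤ l := by exact_mod_cast hkl
    gcongr
  obtain ⟨κ, hκ, hκD, hκlow⟩ := exists_conv_eq_sum_hilbertPiece hα hα2 N k (by linarith)
  obtain ⟨η, hη, hηD, hηlow⟩ := exists_conv_eq_sum_hilbertPiece hα hα2 N l (by linarith)
  have hsk : ∀ k, ∑ i ∈ Finset.range N, hilbertPiece α (2 ^ (k + i)) (fun t => (bump t : ℂ)) ∈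
      skewAdjoint (EllTwo →L[ℂ] EllTwo) := fun k =>
    sum_mem fun i _ => hilbertPiece_mem_skewAdjoint α _ bump
  have hsa := hsk k
  have hsb := hsk l
  rw [hκ] at hu hT hsa
  rw [hη] at hT hsb
  obtain ⟨S, hS, hSmem⟩ := exists_pairs hα hα2 hN hk hl
  set Q := root α (k + l + (N - 1)) with hQ
  have hQ0 : 0 < Q := root_pos _ _
  have hQeq : Q = (2 : ℝ) ^ (((N : ℝ) + 1) / α) * (lowEnd α k * lowEnd α l) := by
    rw [hQ, root, lowEnd, lowEnd, ← Real.rpow_add two_pos, ← Real.rpow_add two_pos, ← add_div,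
      ← add_div]
    congr 2
    push_cast [Nat.cast_sub hN]
    ring
  have hXY0 : 0 < lowEnd α k * lowEnd α l := mul_pos (lowEnd_pos _ _) (lowEnd_pos _ _)
  have hQ1 : lowEnd α k * lowEnd α l ≤ Q := by
    rw [hQeq]
    exact le_mul_of_one_le_left hXY0.le (Real.one_le_rpow one_le_two (by positivity))
  have hQ2 : Q ≤ 2 ^ (N + 1) * (lowEnd α k * lowEnd α l) := by
    rw [hQeq]
    refine mul_le_mul_of_nonneg_right ?_ hXY0.le
    have h : (2 : ℝ) ^ (((N : ℝ) + 1) / α) ≤ (2 : ℝ) ^ (((N + 1 : ℕ) : ℝ)) := by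
      refine Real.rpow_le_rpow_of_exponent_le one_le_two ?_
      push_cast
      exact div_le_self (by positivity) hα.le
    rwa [Real.rpow_natCast] at h
  have hcard := hmain (lowEnd α k) (lowEnd α l) Q ((le_max_left _ _).trans hRk) (by linarith) hε
    hQ1 hQ2 κ η hκD hηD hsa hsb C hu hT S ?_ ?_
  · have h1 : (N : ℝ) * Q ≤ 100 * (24 * C + 3) * Q := by linarith
    exact le_of_mul_le_mul_right h1 hQ0
  · intro p hp
    obtain ⟨i, hi, j, hj, -, m, hm, n, hn, rfl⟩ := hSmem p hp
    exact Finset.mem_product.mpr ⟨(hκlow i hi m hm).1, (hηlow j hj n hn).1⟩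
  · intro p hp
    obtain ⟨i, hi, j, hj, hij, m, hm, n, hn, rfl⟩ := hSmem p hp
    rw [norm_mul]
    have h1 := (hκlow i hi m hm).2
    have h2 := (hηlow j hj n hn).2
    have h3 := root_pos α (k + i)
    have h4 := root_pos α (l + j)
    refine le_trans (le_of_eq ?_) (mul_le_mul h1 h2 (by positivity) (norm_nonneg _))
    rw [← hij]
    field_simp
    norm_num

/-! ### The sparse set of scales -/

/-- This is where `θ < α - 1` enters: the lower block may start at about `M ^ θ`, which for large
`M` is small compared with `M ^ (α - 1)`. -/
theorem exists_block_positions {α θ : ℝ} (hα : 1 < α) (hα2 : α ≤ 3 / 2) (hθ₀ : 0 < θ)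
    (hθ : θ < α - 1) (N g : ℕ) (R : ℝ) {ε : ℝ} (hε : 0 < ε) :
    ∃ k l : ℕ, R ≤ lowEnd α k ∧ lowEnd α k ≤ ε * lowEnd α l ^ (α - 1) ∧ k + N ≤ l ∧
      θ * (l + N) ≤ k ∧ g ≤ θ * k := by
  have hα0 : 0 < α := by linarith
  set ρ : ℝ := Real.logb 2 (max R 1) with hρ
  set e : ℝ := Real.logb 2 ε with he
  have hρ' : (2 : ℝ) ^ ρ = max R 1 :=
    Real.rpow_logb two_pos (by norm_num) (lt_max_of_lt_right one_pos)
  have he' : (2 : ℝ) ^ e = ε := Real.rpow_logb two_pos (by norm_num) hε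
  have hδ : 0 < α - 1 - θ := by linarith
  obtain ⟨l₁, h₁⟩ := exists_nat_ge ((α * ρ + 1) / θ)
  obtain ⟨l₂, h₂⟩ := exists_nat_ge ((θ * N - α * e + (α - 1)) / (α - 1 - θ))
  obtain ⟨l₃, h₃⟩ := exists_nat_ge ((θ * N + 1 + N) / (1 - θ))
  obtain ⟨l₄, h₄⟩ := exists_nat_ge ((g : ℝ) / θ / θ)
  set l := l₁ + l₂ + l₃ + l₄ with hl
  have hl' : (l : ℝ) = l₁ + l₂ + l₃ + l₄ := by rw [hl]; push_cast; ring
  have p1 : (0 : ℝ) ≤ l₁ := Nat.cast_nonneg _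
  have p2 : (0 : ℝ) ≤ l₂ := Nat.cast_nonneg _
  have p3 : (0 : ℝ) ≤ l₃ := Nat.cast_nonneg _
  have p4 : (0 : ℝ) ≤ l₄ := Nat.cast_nonneg _
  have hN0 : (0 : ℝ) ≤ N := Nat.cast_nonneg _
  have q1 : (α * ρ + 1) / θ ≤ l := by linarith
  have q2 : (θ * N - α * e + (α - 1)) / (α - 1 - θ) ≤ l := by linarith
  have q3 : (θ * N + 1 + N) / (1 - θ) ≤ l := by linarith
  have q4 : (g : ℝ) / θ / θ ≤ l := by linarith
  rw [div_le_iff₀ hθ₀] at q1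
  rw [div_le_iff₀ hδ] at q2
  rw [div_le_iff₀ (by linarith)] at q3
  rw [div_le_iff₀ hθ₀, div_le_iff₀ hθ₀] at q4
  set k := ⌈θ * ((l : ℝ) + N)⌉₊ with hk
  have hpos : 0 ≤ θ * ((l : ℝ) + N) := by positivity
  have hk1 : θ * ((l : ℝ) + N) ≤ k := Nat.le_ceil _
  have hk2 : (k : ℝ) < θ * ((l : ℝ) + N) + 1 := Nat.ceil_lt_add_one hpos
  have hθN : 0 ≤ θ * N := by positivity
  refine ⟨k, l, ?_, ?_, ?_, hk1, ?_⟩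
  · refine (le_max_left R 1).trans ?_
    rw [← hρ', lowEnd]
    refine Real.rpow_le_rpow_of_exponent_le one_le_two ?_
    rw [le_div_iff₀ hα0]
    linarith
  · rw [← he', lowEnd, lowEnd, ← Real.rpow_mul zero_le_two, ← Real.rpow_add two_pos]
    refine Real.rpow_le_rpow_of_exponent_le one_le_two ?_
    rw [div_le_iff₀ hα0]
    have h : (e + ((l : ℝ) - 1) / α * (α - 1)) * α = e * α + (l - 1) * (α - 1) := by
      field_simp
    rw [h]
    linarith
  · have h : (k : ℝ) + N ≤ l := by linarith
    exact_mod_cast h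
  · have h1 : θ * (θ * ((l : ℝ) + N)) ≤ θ * k := mul_le_mul_of_nonneg_left hk1 hθ₀.le
    have h2 : 0 ≤ θ * (θ * N) := by positivity
    linarith

theorem truncatedHilbert_eq_sum {α θ M : ℝ} {φ : ℕ → ℝ → ℂ} (J : Finset ℕ)
    (hJ : ∀ j ∈ J, M ^ θ ≤ (2 : ℝ) ^ j ∧ (2 : ℝ) ^ j ≤ M)
    (h : ∀ j, M ^ θ ≤ (2 : ℝ) ^ j → (2 : ℝ) ^ j ≤ M → j ∉ J → φ j = fun _ => 0) :
    truncatedHilbert α θ φ M = ∑ j ∈ J, hilbertPiece α (2 ^ j) (φ j) := by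
  classical
  rw [truncatedHilbert]
  simp only [finsum_eq_if]
  rw [finsum_eq_sum_of_support_subset (s := J)]
  · exact Finset.sum_congr rfl fun j hj => if_pos (hJ j hj)
  · intro j hj
    rw [Function.mem_support] at hj
    by_contra hjJ
    refine hj ?_
    split_ifs with hc
    · rw [h j hc.1 hc.2 (fun hm => hjJ (Finset.mem_coe.mpr hm)), hilbertPiece_zero]
    · rfl

theorem two_pow_rpow_le_iff (n j : ℕ) (θ : ℝ) :
    ((2 : ℝ) ^ n) ^ θ ≤ 2 ^ j ↔ θ * n ≤ j := by
  rw [← Real.rpow_natCast, ← Real.rpow_natCast, ← Real.rpow_mul zero_le_two,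
    Real.rpow_le_rpow_left_iff one_lt_two, mul_comm]

/-- The scale `2 ^ j` belongs to the `N`-th pair of blocks, for the starting positions `p`. -/
def IsActive (p : ℕ → ℕ × ℕ) (j : ℕ) : Prop :=
  ∃ N, ∃ i < N, j = (p N).1 + i ∨ j = (p N).2 + i

open Classical in
/-- The bump function at the active scales, and `0` at all others. -/
noncomputable def sparseCutoff (p : ℕ → ℕ × ℕ) (j : ℕ) (t : ℝ) : ℂ :=
  if IsActive p j then (bump t : ℂ) else 0

theorem sparseCutoff_of_isActive {p : ℕ → ℕ × ℕ} {j : ℕ} (h : IsActive p j) :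
    sparseCutoff p j = fun t => (bump t : ℂ) := by
  ext t
  exact if_pos h

theorem sparseCutoff_of_not_isActive {p : ℕ → ℕ × ℕ} {j : ℕ} (h : ¬ IsActive p j) :
    sparseCutoff p j = fun _ => 0 := by
  ext t
  exact if_neg h

theorem isUniformCutoff_sparseCutoff (p : ℕ → ℕ × ℕ) : IsUniformCutoff (sparseCutoff p) := by
  have hsm : ContDiff ℝ ∞ (fun t : ℝ => (bump t : ℂ)) :=
    Complex.ofRealCLM.contDiff.comp bump.contDiff
  have hts : tsupport (fun t : ℝ => (bump t : ℂ)) ⊆ Set.Icc (3 / 4) (7 / 4) := by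
    refine (closure_mono fun t ht => ?_).trans tsupport_bump
    rw [Function.mem_support] at ht ⊢
    exact_mod_cast ht
  refine ⟨fun j => ?_, ⟨3 / 4, 7 / 4, by norm_num, by norm_num, fun j => ?_⟩, fun n => ?_⟩
  · by_cases h : IsActive p j
    · rw [sparseCutoff_of_isActive h]
      exact hsm
    · rw [sparseCutoff_of_not_isActive h]
      exact contDiff_const
  · by_cases h : IsActive p j
    · rw [sparseCutoff_of_isActive h]
      exact hts
    · rw [sparseCutoff_of_not_isActive h]
      simp [tsupport]
  · have hcs : HasCompactSupport (fun t : ℝ => (bump t : ℂ)) :=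
      isCompact_Icc.of_isClosed_subset (isClosed_tsupport _) hts
    obtain ⟨B, hB⟩ := (hcs.iteratedFDeriv (𝕜 := ℝ) n).exists_bound_of_continuous
      (hsm.continuous_iteratedFDeriv (by exact_mod_cast le_top))
    simp only [norm_iteratedFDeriv_eq_norm_iteratedDeriv] at hB
    refine ⟨B, fun j t => ?_⟩
    by_cases h : IsActive p j
    · rw [sparseCutoff_of_isActive h]
      exact hB t
    · rw [sparseCutoff_of_not_isActive h]
      have hB0 : 0 ≤ B := (norm_nonneg _).trans (hB 0)
      simpa using hB0

theorem truncatedHilbert_mem_skewAdjoint (α θ : ℝ) (p : ℕ → ℕ × ℕ) (M : ℝ) :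
    truncatedHilbert α θ (sparseCutoff p) M ∈ skewAdjoint (EllTwo →L[ℂ] EllTwo) := by
  refine finsum_induction (· ∈ skewAdjoint (EllTwo →L[ℂ] EllTwo)) (zero_mem _)
    (fun _ _ => add_mem) fun j => ?_
  refine finsum_induction (· ∈ skewAdjoint (EllTwo →L[ℂ] EllTwo)) (zero_mem _)
    (fun _ _ => add_mem) fun _ => ?_
  by_cases h : IsActive p j
  · rw [sparseCutoff_of_isActive h]
    exact hilbertPiece_mem_skewAdjoint α _ bump
  · rw [sparseCutoff_of_not_isActive h, hilbertPiece_zero]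
    exact zero_mem _

/-- The starting positions of the blocks are separated so well that every truncation at the top of
a block sees no block of another pair. -/
structure IsSeparated (θ : ℝ) (p : ℕ → ℕ × ℕ) : Prop where
  add_le : ∀ N, (p N).1 + N ≤ (p N).2
  mul_le : ∀ N, θ * ((p N).2 + N) ≤ (p N).1
  prev_le : ∀ N, (((p N).2 + N : ℕ) : ℝ) ≤ θ * (p (N + 1)).1

theorem IsSeparated.top_le {θ : ℝ} (hθ : θ < 1) {p : ℕ → ℕ × ℕ} (hp : IsSeparated θ p)
    {N N' : ℕ} (h : N < N') : (((p N).2 + N : ℕ) : ℝ) ≤ θ * (p N').1 := by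
  induction N', h using Nat.le_induction with
  | base => exact hp.prev_le N
  | succ n _ ih =>
    have h1 := hp.prev_le n
    have h2 : (((p n).1 + n : ℕ) : ℝ) ≤ ((p n).2 : ℝ) := by exact_mod_cast hp.add_le n
    push_cast at h1 h2 ih ⊢
    have h3 : (0 : ℝ) ≤ (p n).1 := Nat.cast_nonneg _
    have h4 : (0 : ℝ) ≤ n := Nat.cast_nonneg _
    nlinarith

theorem IsSeparated.mem_block {θ : ℝ} (hθ : θ < 1) {p : ℕ → ℕ × ℕ}
    (hp : IsSeparated θ p) {N j n : ℕ} (hj : IsActive p j) (hlow : θ * (p N).1 ≤ j)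
    (hn : n < (p N).2 + N) (hjn : j ≤ n) :
    (∃ i < N, j = (p N).1 + i) ∨ ∃ i < N, j = (p N).2 + i := by
  obtain ⟨N', i, hi, hji⟩ := hj
  have hadd := hp.add_le N'
  rcases lt_trichotomy N' N with h | rfl | h
  · exfalso
    have h1 := hp.top_le hθ h
    have h2 : (((p N').2 + N' : ℕ) : ℝ) ≤ j := h1.trans hlow
    have h3 : (p N').2 + N' ≤ j := by exact_mod_cast h2
    omega
  · exact hji.imp (fun h => ⟨i, hi, h⟩) fun h => ⟨i, hi, h⟩
  · exfalso
    have h1 := hp.top_le hθ h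
    have h2 : θ * (p N').1 ≤ (p N').1 := mul_le_of_le_one_left (Nat.cast_nonneg _) hθ.le
    have h3 : (p N).2 + N ≤ (p N').1 := by exact_mod_cast h1.trans h2
    omega

theorem truncatedHilbert_lower_block {α θ : ℝ} (hθ₀ : 0 < θ) (hθ : θ < 1) {p : ℕ → ℕ × ℕ}
    (hp : IsSeparated θ p) {N : ℕ} (hN : 1 ≤ N) :
    truncatedHilbert α θ (sparseCutoff p) (2 ^ ((p N).1 + (N - 1))) =
      ∑ i ∈ Finset.range N, hilbertPiece α (2 ^ ((p N).1 + i)) (fun t => (bump t : ℂ)) := by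
  classical
  have hadd := hp.add_le N
  have hmul := hp.mul_le N
  have hcast : (((p N).1 + (N - 1) : ℕ) : ℝ) ≤ ((p N).2 : ℝ) + N := by
    exact_mod_cast (by omega : (p N).1 + (N - 1) ≤ (p N).2 + N)
  rw [truncatedHilbert_eq_sum ((Finset.range N).image fun i => (p N).1 + i),
    Finset.sum_image (fun i _ j _ h => by omega)]
  · refine Finset.sum_congr rfl fun i hi => ?_
    rw [sparseCutoff_of_isActive ⟨N, i, Finset.mem_range.mp hi, Or.inl rfl⟩]
  · intro j hj
    obtain ⟨i, hi, rfl⟩ := Finset.mem_image.mp hj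
    have hi := Finset.mem_range.mp hi
    refine ⟨?_, pow_le_pow_right₀ one_le_two (by omega)⟩
    rw [two_pow_rpow_le_iff]
    have h1 := mul_le_mul_of_nonneg_left hcast hθ₀.le
    push_cast at h1 ⊢
    have : (0 : ℝ) ≤ i := Nat.cast_nonneg _
    linarith
  · intro j hj1 hj2 hjJ
    refine sparseCutoff_of_not_isActive fun hact => ?_
    rw [two_pow_rpow_le_iff] at hj1
    have hj2 := (pow_le_pow_iff_right₀ (one_lt_two : (1 : ℝ) < 2)).mp hj2
    have hlow : θ * (p N).1 ≤ j := by
      refine le_trans ?_ hj1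
      gcongr
      omega
    rcases hp.mem_block hθ hact hlow (by omega) hj2 with ⟨i, hi, rfl⟩ | ⟨i, hi, rfl⟩
    · exact hjJ (Finset.mem_image_of_mem _ (Finset.mem_range.mpr hi))
    · omega

theorem truncatedHilbert_both_blocks {α θ : ℝ} (hθ₀ : 0 < θ) (hθ : θ < 1) {p : ℕ → ℕ × ℕ}
    (hp : IsSeparated θ p) {N : ℕ} (hN : 1 ≤ N) :
    truncatedHilbert α θ (sparseCutoff p) (2 ^ ((p N).2 + (N - 1))) =
      ∑ i ∈ Finset.range N, hilbertPiece α (2 ^ ((p N).1 + i)) (fun t => (bump t : ℂ)) +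
      ∑ i ∈ Finset.range N, hilbertPiece α (2 ^ ((p N).2 + i)) (fun t => (bump t : ℂ)) := by
  classical
  have hadd := hp.add_le N
  have hmul := hp.mul_le N
  have hcast : (((p N).2 + (N - 1) : ℕ) : ℝ) ≤ ((p N).2 : ℝ) + N := by
    exact_mod_cast (by omega : (p N).2 + (N - 1) ≤ (p N).2 + N)
  have hdisj : Disjoint ((Finset.range N).image fun i => (p N).1 + i)
      ((Finset.range N).image fun i => (p N).2 + i) := by
    refine Finset.disjoint_left.mpr fun j h1 h2 => ?_
    obtain ⟨i, hi, rfl⟩ := Finset.mem_image.mp h1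
    obtain ⟨i', -, h⟩ := Finset.mem_image.mp h2
    have := Finset.mem_range.mp hi
    omega
  rw [truncatedHilbert_eq_sum (((Finset.range N).image fun i => (p N).1 + i) ∪
    ((Finset.range N).image fun i => (p N).2 + i)), Finset.sum_union hdisj,
    Finset.sum_image (fun i _ j _ h => by omega), Finset.sum_image (fun i _ j _ h => by omega)]
  · congr 1
    · refine Finset.sum_congr rfl fun i hi => ?_
      rw [sparseCutoff_of_isActive ⟨N, i, Finset.mem_range.mp hi, Or.inl rfl⟩]
    · refine Finset.sum_congr rfl fun i hi => ?_
      rw [sparseCutoff_of_isActive ⟨N, i, Finset.mem_range.mp hi, Or.inr rfl⟩]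
  · intro j hj
    have hj' : (p N).1 ≤ j ∧ j ≤ (p N).2 + (N - 1) := by
      rcases Finset.mem_union.mp hj with h | h
      · obtain ⟨i, hi, rfl⟩ := Finset.mem_image.mp h
        have hi := Finset.mem_range.mp hi
        omega
      · obtain ⟨i, hi, rfl⟩ := Finset.mem_image.mp h
        have hi := Finset.mem_range.mp hi
        omega
    refine ⟨?_, pow_le_pow_right₀ one_le_two hj'.2⟩
    rw [two_pow_rpow_le_iff]
    have h1 := mul_le_mul_of_nonneg_left hcast hθ₀.le
    have h2 : ((p N).1 : ℝ) ≤ j := by exact_mod_cast hj'.1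
    linarith
  · intro j hj1 hj2 hjJ
    refine sparseCutoff_of_not_isActive fun hact => ?_
    rw [two_pow_rpow_le_iff] at hj1
    have hj2 := (pow_le_pow_iff_right₀ (one_lt_two : (1 : ℝ) < 2)).mp hj2
    have hlow : θ * (p N).1 ≤ j := by
      refine le_trans ?_ hj1
      gcongr
      omega
    refine hjJ (Finset.mem_union.mpr ?_)
    rcases hp.mem_block hθ hact hlow (by omega) hj2 with ⟨i, hi, rfl⟩ | ⟨i, hi, rfl⟩
    · exact Or.inl (Finset.mem_image_of_mem _ (Finset.mem_range.mpr hi))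
    · exact Or.inr (Finset.mem_image_of_mem _ (Finset.mem_range.mpr hi))

end RoughHilbert

open RoughHilbert in
theorem mainTheorem3 (α θ : ℝ) (hα₁ : 1 < α) (hα₂ : α ≤ 1 + 1 / 1000)
    (hθ₀ : 0 < θ) (hθ : θ < α - 1) :
    ∃ φ : ℕ → ℝ → ℂ, IsUniformCutoff φ ∧ ∃ Γ : Set ℂ, IsCompact Γ ∧
      (∃ C_I : ℝ, ∀ M : ℝ, 0 ≤ M → ∀ z ∈ Γ,
        IsUnit (z • (1 : EllTwo →L[ℂ] EllTwo) + truncatedHilbert α θ φ M) ∧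
        ‖Ring.inverse (z • (1 : EllTwo →L[ℂ] EllTwo) + truncatedHilbert α θ φ M)‖ ≤ C_I) ∧
      ¬ ∃ C : ℝ≥0, ∀ M : ℝ, 0 ≤ M → ∀ z ∈ Γ,
        WeakTypeBound
          (Ring.inverse (z • (1 : EllTwo →L[ℂ] EllTwo) + truncatedHilbert α θ φ M)) C := by
  have hα2 : α ≤ 3 / 2 := by linarith
  have hθ1 : θ < 1 := by linarith
  have hbound : ∀ N : ℕ, ∃ R ε : ℝ, 0 < ε ∧ (1 ≤ N → ∀ k l : ℕ, R ≤ lowEnd α k → k ≤ l →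
      lowEnd α k ≤ ε * lowEnd α l ^ (α - 1) → ∀ C : ℝ≥0,
      WeakTypeBound (Ring.inverse (1 + ∑ i ∈ Finset.range N,
        hilbertPiece α (2 ^ (k + i)) (fun t => (bump t : ℂ)))) C →
      WeakTypeBound (Ring.inverse (1 + (∑ i ∈ Finset.range N,
        hilbertPiece α (2 ^ (k + i)) (fun t => (bump t : ℂ)) + ∑ i ∈ Finset.range N,
        hilbertPiece α (2 ^ (l + i)) (fun t => (bump t : ℂ))))) C →
      (N : ℝ) ≤ 100 * (24 * C + 3)) := by
    intro N
    by_cases hN : 1 ≤ N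
    · obtain ⟨R, ε, hε, h⟩ := exists_natCast_le_of_weakTypeBound hα₁ hα2 hN
      exact ⟨R, ε, hε, fun _ => h⟩
    · exact ⟨0, 1, one_pos, fun h => absurd h hN⟩
  choose R ε hε hbound using hbound
  choose k l hk hkl hadd hmul hgap using fun N g : ℕ =>
    exists_block_positions hα₁ hα2 hθ₀ hθ N g (R N) (hε N)
  -- the `N`-th pair of blocks is placed beyond the end of the one before it
  set p : ℕ → ℕ × ℕ := fun N => Nat.rec (k 0 0, l 0 0)
    (fun n q => (k (n + 1) (q.2 + n), l (n + 1) (q.2 + n))) N with hp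
  have hp_eq : ∀ N, ∃ g, p N = (k N g, l N g) := fun N => by
    cases N with
    | zero => exact ⟨0, rfl⟩
    | succ n => exact ⟨(p n).2 + n, rfl⟩
  have hsep : IsSeparated θ p := by
    refine ⟨fun N => ?_, fun N => ?_, fun N => hgap (N + 1) ((p N).2 + N)⟩
    · obtain ⟨g, hg⟩ := hp_eq N
      rw [hg]
      exact hadd N g
    · obtain ⟨g, hg⟩ := hp_eq N
      rw [hg]
      exact hmul N g
  refine ⟨sparseCutoff p, isUniformCutoff_sparseCutoff p, {1}, isCompact_singleton,
    ⟨1, fun M _ z hz => ?_⟩, ?_⟩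
  · rw [Set.mem_singleton_iff.mp hz, one_smul]
    have h := truncatedHilbert_mem_skewAdjoint α θ p M
    exact ⟨isUnit_one_add h, norm_inverse_one_add_le h⟩
  · rintro ⟨C, hC⟩
    obtain ⟨N, hN⟩ := exists_nat_gt (100 * (24 * (C : ℝ) + 3))
    have hN1 : 1 ≤ N := by
      have h1 : (0 : ℝ) < N := lt_of_le_of_lt (by positivity) hN
      exact_mod_cast h1
    have h1 := hC (2 ^ ((p N).1 + (N - 1))) (by positivity) 1 rfl
    have h2 := hC (2 ^ ((p N).2 + (N - 1))) (by positivity) 1 rfl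
    rw [one_smul, truncatedHilbert_lower_block hθ₀ hθ1 hsep hN1] at h1
    rw [one_smul, truncatedHilbert_both_blocks hθ₀ hθ1 hsep hN1] at h2
    obtain ⟨g, hg⟩ := hp_eq N
    rw [hg] at h1 h2
    have h3 := hadd N g
    exact absurd (hbound N hN1 _ _ (hk N g) (by omega) (hkl N g) C h1 h2) (not_le.mpr hN)
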